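/- Let $n\ge 2$ and let $\mathcal C=\partial W\subset\mathbb R^{n+1}$ be the cone over a smooth embedded closed hypersurface of $\mathbb S^n$, where $W$ is the closure of its interior. Write $F_t(\cdot)$ for the level set flow, assume that the level set flow of $\mathcal C$ fattens, and put $\mathrm{Gap}=F_1(\mathcal C)$. Assume that the outermost expander $\Sigma=\partial F_1(W)$ is a smooth embedded hypersurface which is smoothly asymptotic to $\mathcal C$ (that is, $\rho\Sigma\to\mathcal C$ in $C^\infty_{loc}(\mathbb R^{n+1}\setminus\{0\})$ as $\rho\searrow0$) and satisfies the self-expander equation $\mathbf H-\tfrac12\mathbf x^\perp=0$. Let $\nu$ be the smooth unit normal of $\Sigma$ pointing into $\mathrm{Gap}$, and let $$L=\Delta_\Sigma+\tfrac12\,\mathbf x\cdot\nabla_\Sigma-\tfrac12+|A_\Sigma|^2 .$$ Let $v$ be a positive smooth function on $\Sigma$ with $Lv=0$ and $v=r+w$, where $r=|\mathbf x|$ and $|\nabla_\Sigma^\ell w|=O(r^{-1-\ell})$ as $r\to\infty$ for $\ell=0,1$. For $\rho>0$ write $\Sigma_\rho=\Sigma\cap B_\rho(0)$ and $\partial\Sigma_\rho=\Sigma\cap\partial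 B_\rho(0)$. Then there is $R_0>0$ such that for every $R\ge R_0$ the following holds. Let $\phi_{3R}$ be a positive first Dirichlet eigenfunction of $-L$ on $\Sigma_{3R}$: it is smooth and positive on $\Sigma_{3R}$, continuous up to $\partial\Sigma_{3R}$, and satisfies $L\phi_{3R}+\mu_{3R}\phi_{3R}=0$ in $\Sigma_{3R}$ and $\phi_{3R}=0$ on $\partial\Sigma_{3R}$. (Here $\mu_{3R}$ is a constant if $\Sigma_{3R}$ is connected, and in general a constant on each connected component; $\phi_{3R}$ may be normalized arbitrarily.) Then there is $\alpha_0>0$ such that for every $\alpha\in(0,\alpha_0)$, with $f=v+\alpha\phi_{3R}$, $h=\max_{\partial\Sigma_R}f$ and $$u(\mathbf x)=\begin{cases} f(\mathbf x), & |\mathbf x|\le R,\\ \min\{f(\mathbf x),h\}, & R<|\mathbf x|\le 2R,\\ h, & |\mathbf x|>2R,\end{cases}\qquad \mathbf x\in\Sigma,$$ there is $s_0>0$ such that for every $s\in(0,s_0)$ the static family $$\tau\mapsto\Gamma_s=\{\mathbf x+s\,u(\mathbf x)\,\nu(\mathbf x):\mathbf x\in\Sigma\}$$ is a supersolution of the rescaled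 mean curvature flow $(\partial_\tau\mathbf x)^\perp=\mathbf H-\tfrac12\mathbf x^\perp$. This means that $\sup_\Sigma |su|\,|A_\Sigma|<1$ (so that the normal graph is admissible) and that no smooth rescaled mean curvature flow touches $\Gamma_s$ from below with respect to $\nu$ at an interior point: it is impossible that a smooth rescaled mean curvature flow defined on $(a,b]$ has a point of $\Gamma_s$ at time $b$ while, near that point and for times up to and close to $b$, it lies weakly below $\Gamma_s$. -/

import Mathlib

open scoped ContDiff Manifold Topology

noncomputable section

namespace ExpanderBarrier

/-- The ambient Euclidean space `ℝⁿ⁺¹`. -/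
abbrev Amb (n : ℕ) := EuclideanSpace ℝ (Fin (n + 1))

/-- The parameter space `ℝⁿ`. -/
abbrev Par (n : ℕ) := EuclideanSpace ℝ (Fin n)

/-! ### Parametrized immersions and their mean curvature -/

section Immersions

variable {n : ℕ}

/-- The coefficients `g_{ij} = ∂_i Y · ∂_j Y` of the induced metric of `Y : ℝⁿ → ℝⁿ⁺¹`. -/
def inducedMetric (Y : Par n → Amb n) (z : Par n) : Matrix (Fin n) (Fin n) ℝ :=
  Matrix.of fun i j =>
    inner ℝ (fderiv ℝ Y z (EuclideanSpace.single i 1)) (fderiv ℝ Y z (EuclideanSpace.single j 1))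

/-- The normal component `w^⊥` of a vector `w` along the immersion `Y` at `z`. -/
def normalPart (Y : Par n → Amb n) (z : Par n) (w : Amb n) : Amb n :=
  ((LinearMap.range (fderiv ℝ Y z).toLinearMap)ᗮ).starProjection w

/-- The mean curvature vector `𝐇 = g^{ij} (∂_i ∂_j Y)^⊥` of the immersion `Y` at `z`. -/
def meanCurvatureVector (Y : Par n → Amb n) (z : Par n) : Amb n :=
  normalPart Y z (∑ i, ∑ j, (inducedMetric Y z)⁻¹ i j •
    fderiv ℝ (fderiv ℝ Y) z (EuclideanSpace.single i 1) (EuclideanSpace.single j 1))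

/-- `X : U × (a, b] → ℝⁿ⁺¹` is a smooth (parametrized) forward rescaled mean curvature flow:
smooth up to the final time `b`, immersed at each time, and
`(∂_τ 𝐱)^⊥ = 𝐇 - 𝐱^⊥ / 2`. Here `U ⊆ ℝⁿ` is open, so this is one coordinate patch of a flow of
`n`-manifolds. -/
structure IsRescaledMCF (U : Set (Par n)) (a b : ℝ) (X : Par n → ℝ → Amb n) : Prop where
  isOpen : IsOpen U
  lt : a < b
  smooth : ContDiffOn ℝ ∞ (fun q : Par n × ℝ => X q.1 q.2) (U ×ˢ Set.Ioc a b)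
  immersion : ∀ z ∈ U, ∀ τ ∈ Set.Ioc a b, Function.Injective (fderiv ℝ (fun y => X y τ) z)
  flow : ∀ z ∈ U, ∀ τ ∈ Set.Ioc a b,
    normalPart (fun y => X y τ) z (derivWithin (fun σ => X z σ) (Set.Ioc a b) τ) =
      meanCurvatureVector (fun y => X y τ) z
        - (1 / 2 : ℝ) • normalPart (fun y => X y τ) z (X z τ)

end Immersions

/-! ### Classical mean curvature flows and the level set flow -/

section LevelSetFlow

variable {n : ℕ} [NeZero n]

/-- `f : M × [a, b] → ℝⁿ⁺¹` is a classical mean curvature flow of the compact `n`-manifold `M`,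
possibly with boundary: continuous, smooth on `(M \ ∂M) × (a, b]`, injective at each time, and
`(∂_t f)^⊥ = 𝐇` on the interior (computed in the preferred chart at the point). -/
structure IsClassicalMCF (M : Type) [TopologicalSpace M] [ChartedSpace (EuclideanHalfSpace n) M]
    (a b : ℝ) (f : M → ℝ → Amb n) : Prop where
  isManifold : IsManifold (𝓡∂ n) ∞ M
  compact : CompactSpace M
  lt : a < b
  continuousOn : ContinuousOn (fun q : M × ℝ => f q.1 q.2) (Set.univ ×ˢ Set.Icc a b)
  smooth : ContMDiffOn ((𝓡∂ n).prod 𝓘(ℝ, ℝ)) 𝓘(ℝ, Amb n) ∞ (fun q : M × ℝ => f q.1 q.2)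
    ((𝓡∂ n).interior M ×ˢ Set.Ioc a b)
  injective : ∀ t ∈ Set.Icc a b, Function.Injective fun p => f p t
  immersion : ∀ p ∈ (𝓡∂ n).interior M, ∀ t ∈ Set.Ioc a b,
    Function.Injective
      (fderiv ℝ (fun z => f ((extChartAt (𝓡∂ n) p).symm z) t) (extChartAt (𝓡∂ n) p p))
  flow : ∀ p ∈ (𝓡∂ n).interior M, ∀ t ∈ Set.Ioc a b,
    normalPart (fun z => f ((extChartAt (𝓡∂ n) p).symm z) t) (extChartAt (𝓡∂ n) p p)
        (derivWithin (fun σ => f p σ) (Set.Ioc a b) t) =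
      meanCurvatureVector (fun z => f ((extChartAt (𝓡∂ n) p).symm z) t) (extChartAt (𝓡∂ n) p p)

/-- The space-time track `⋃_{t ∈ [a, b]} f(M, t) × {t}`. -/
def track {M : Type} (a b : ℝ) (f : M → ℝ → Amb n) : Set (Amb n × ℝ) :=
  {q | q.2 ∈ Set.Icc a b ∧ ∃ p, f p q.2 = q.1}

/-- The heat boundary: the initial slice together with the track of `∂M`. -/
def heatBoundary {M : Type} [TopologicalSpace M] [ChartedSpace (EuclideanHalfSpace n) M]
    (a b : ℝ) (f : M → ℝ → Amb n) : Set (Amb n × ℝ) :=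
  {q | (q.2 = a ∧ ∃ p, f p a = q.1) ∨
    (q.2 ∈ Set.Icc a b ∧ ∃ p ∈ (𝓡∂ n).boundary M, f p q.2 = q.1)}

/-- The stages exhausting the complement of the level set flow of `Γ ⊆ ℝⁿ⁺¹`: stage `0` is the
complement of `Γ` at time `0`; stage `k + 1` is the union of all classical flows which are disjoint
from `Γ × {0}` and whose heat boundary lies in stage `k`. -/
def swept (Γ : Set (Amb n)) : ℕ → Set (Amb n × ℝ)
  | 0 => {q | q.2 = 0 ∧ q.1 ∉ Γ}
  | k + 1 => {q | ∃ (M : Type) (_ : TopologicalSpace M)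
      (_ : ChartedSpace (EuclideanHalfSpace n) M) (a b : ℝ) (f : M → ℝ → Amb n),
      IsClassicalMCF M a b f ∧ Disjoint (track a b f) (Γ ×ˢ {(0 : ℝ)}) ∧
      heatBoundary a b f ⊆ swept Γ k ∧ q ∈ track a b f}

/-- The time `t` slice `F_t(Γ)` (for `t ≥ 0`) of the level set flow of `Γ ⊆ ℝⁿ⁺¹`. -/
def levelSetFlow (Γ : Set (Amb n)) (t : ℝ) : Set (Amb n) :=
  {x | ∀ k, (x, t) ∉ swept Γ k}

/-- The level set flow of `Γ` fattens: it has interior at some time. -/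
def Fattens (Γ : Set (Amb n)) : Prop :=
  ∃ t : ℝ, 0 ≤ t ∧ (interior (levelSetFlow Γ t)).Nonempty

end LevelSetFlow

/-! ### Cones and smooth convergence -/

section Cones

variable {n : ℕ}

/-- `S` is a smooth, embedded, closed hypersurface of the unit sphere `𝕊ⁿ ⊆ ℝⁿ⁺¹`: near each of its
points it is the zero set in `𝕊ⁿ` of a smooth function whose differential does not vanish on the
tangent space of `𝕊ⁿ`. -/
structure IsSmoothLink (S : Set (Amb n)) : Prop where
  isClosed : IsClosed S
  subset : S ⊆ Metric.sphere 0 1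
  smooth : ∀ p ∈ S, ∃ F : Amb n → ℝ, ContDiff ℝ ∞ F ∧
    (∀ᶠ x in 𝓝 p, x ∈ Metric.sphere (0 : Amb n) 1 → (x ∈ S ↔ F x = 0)) ∧
    ∃ w : Amb n, inner ℝ w p = 0 ∧ fderiv ℝ F p w ≠ 0

/-- The cone over `S`. -/
def coneOver (S : Set (Amb n)) : Set (Amb n) :=
  {y | ∃ t : ℝ, 0 ≤ t ∧ ∃ x ∈ S, y = t • x}

/-- Convergence `N ρ → N₀` along the filter `l` in `C^∞_loc(Ω)` as embedded hypersurfaces: near a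
point of `Ω \ N₀` the sets `N ρ` are eventually empty, and near a point `p ∈ Ω ∩ N₀` there is a
cylinder `{p + T z + y e : |z| < r, |y| < r}`, with `T` a linear isometry from `ℝⁿ` onto `e^⊥`, in
which `N₀` and eventually `N ρ` are the graphs of smooth functions `u₀`, `u ρ`, such that all
derivatives of `u ρ` converge uniformly to those of `u₀`. -/
def ConvergesSmoothlyOn (N : ℝ → Set (Amb n)) (l : Filter ℝ) (N₀ Ω : Set (Amb n)) : Prop :=
  (∀ p ∈ Ω, p ∉ N₀ → ∃ r > 0, ∀ᶠ ρ in l, Disjoint (Metric.ball p r) (N ρ)) ∧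
  (∀ p ∈ Ω, p ∈ N₀ → ∃ (T : Par n →ₗᵢ[ℝ] Amb n) (e : Amb n) (r : ℝ) (u₀ : Par n → ℝ)
      (u : ℝ → Par n → ℝ),
    ‖e‖ = 1 ∧ (∀ z, inner ℝ (T z) e = 0) ∧ 0 < r ∧
    ContDiffOn ℝ ∞ u₀ (Metric.ball 0 r) ∧
    (∀ z ∈ Metric.ball (0 : Par n) r, ∀ y : ℝ, |y| < r → (p + T z + y • e ∈ N₀ ↔ y = u₀ z)) ∧
    (∀ᶠ ρ in l, ContDiffOn ℝ ∞ (u ρ) (Metric.ball 0 r) ∧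
      ∀ z ∈ Metric.ball (0 : Par n) r, ∀ y : ℝ, |y| < r → (p + T z + y • e ∈ N ρ ↔ y = u ρ z)) ∧
    ∀ k : ℕ, TendstoUniformlyOn (fun ρ => iteratedFDeriv ℝ k (u ρ)) (iteratedFDeriv ℝ k u₀) l
      (Metric.ball 0 r))

/-- `N` is smoothly asymptotic to the cone `C`: `ρ N → C` in `C^∞_loc(ℝⁿ⁺¹ \ {0})` as `ρ ↘ 0`. -/
def IsAsymptoticTo (N C : Set (Amb n)) : Prop :=
  ConvergesSmoothlyOn (fun ρ => (fun x => ρ • x) '' N) (𝓝[>] 0) C {0}ᶜ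

end Cones

/-! ### Oriented hypersurfaces

A smooth function (or vector field) on a hypersurface is represented by a function on `ℝⁿ⁺¹` which
is smooth at the points of the hypersurface. The tangential quantities below depend only on the
restriction of that function to the hypersurface. -/

section Hypersurfaces

variable {n : ℕ}

/-- `N ⊆ ℝⁿ⁺¹` is a smooth embedded hypersurface with smooth unit normal field `ν`. -/
structure IsOrientedHypersurface (N : Set (Amb n)) (ν : Amb n → Amb n) : Prop where
  smooth_normal : ∀ x ∈ N, ContDiffAt ℝ ∞ ν x
  norm_normal : ∀ x ∈ N, ‖ν x‖ = 1
  smooth : ∀ p ∈ N, ∃ F : Amb n → ℝ, ContDiff ℝ ∞ F ∧ (∀ᶠ x in 𝓝 p, x ∈ N ↔ F x = 0) ∧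
    HasGradientAt F (ν p) p

/-- Orthogonal projection to the tangent space `ν(x)^⊥` at `x`. -/
def tangentPart (ν : Amb n → Amb n) (x w : Amb n) : Amb n :=
  w - inner ℝ (ν x) w • ν x

/-- The projection of the `i`-th standard basis vector to the tangent space at `x`. The trace of
a bilinear form `B` over the tangent space is `∑ i, B (tangentFrame ν x i) (tangentFrame ν x i)`. -/
def tangentFrame (ν : Amb n → Amb n) (x : Amb n) (i : Fin (n + 1)) : Amb n :=
  tangentPart ν x (EuclideanSpace.single i 1)

/-- The scalar mean curvature `H = tr S`, where `S = -Dν` is the shape operator; `𝐇 = H ν`. -/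
def meanCurvature (ν : Amb n → Amb n) (x : Amb n) : ℝ :=
  -∑ i, inner ℝ (fderiv ℝ ν x (tangentFrame ν x i)) (tangentFrame ν x i)

/-- The squared norm `|A|²` of the second fundamental form. -/
def sqNormA (ν : Amb n → Amb n) (x : Amb n) : ℝ :=
  ∑ i, ‖fderiv ℝ ν x (tangentFrame ν x i)‖ ^ 2

/-- The tangential gradient `∇_N g`. -/
def tangentGradient (ν : Amb n → Amb n) (g : Amb n → ℝ) (x : Amb n) : Amb n :=
  tangentPart ν x (gradient g x)

/-- The Laplace–Beltrami operator `Δ_N g = tr_{TN} D²g + 𝐇 · Dg`. -/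
def laplaceBeltrami (ν : Amb n → Amb n) (g : Amb n → ℝ) (x : Amb n) : ℝ :=
  ∑ i, fderiv ℝ (fderiv ℝ g) x (tangentFrame ν x i) (tangentFrame ν x i)
    + meanCurvature ν x * fderiv ℝ g x (ν x)

/-- The Jacobi operator `L = Δ + (𝐱/2) · ∇ - 1/2 + |A|²` of an expander. -/
def jacobiOp (ν : Amb n → Amb n) (g : Amb n → ℝ) (x : Amb n) : ℝ :=
  laplaceBeltrami ν g x + (1 / 2) * inner ℝ x (tangentGradient ν g x) - (1 / 2) * g x
    + sqNormA ν x * g x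

/-- The self-expander equation `𝐇 - 𝐱^⊥ / 2 = 0`. -/
def IsSelfExpander (N : Set (Amb n)) (ν : Amb n → Amb n) : Prop :=
  ∀ x ∈ N, meanCurvature ν x - (1 / 2) * inner ℝ x (ν x) = 0

/-- `v` is a positive Jacobi field on `N` of the form `v = r + w`, `r = |𝐱|`, with
`|∇^ℓ w| = O(r^{-1-ℓ})` for `ℓ = 0, 1`. -/
structure IsPositiveJacobiField (N : Set (Amb n)) (ν : Amb n → Amb n) (v : Amb n → ℝ) :
    Prop where
  smooth : ∀ x ∈ N, ContDiffAt ℝ ∞ v x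
  pos : ∀ x ∈ N, 0 < v x
  jacobi : ∀ x ∈ N, jacobiOp ν v x = 0
  decay : ∃ K r₁ : ℝ, 0 < r₁ ∧ ∀ x ∈ N, r₁ ≤ ‖x‖ →
    |v x - ‖x‖| ≤ K / ‖x‖ ∧ ‖tangentGradient ν (fun y => v y - ‖y‖) x‖ ≤ K / ‖x‖ ^ 2

/-- `φ` is a positive first Dirichlet eigenfunction of `-L` on `N ∩ B_ρ(0)` with eigenvalue `μ`:
`L φ + μ φ = 0` in `N ∩ B_ρ(0)`, `φ > 0` there, and `φ = 0` on `N ∩ ∂B_ρ(0)`. When `N ∩ B_ρ(0)` is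
disconnected, each component has its own first eigenvalue; thus `μ` is a locally constant function
on `N ∩ B_ρ(0)`, a single number when this set is connected. No normalization of `φ` is imposed. -/
structure IsFirstDirichletEigenfunction (N : Set (Amb n)) (ν : Amb n → Amb n) (ρ : ℝ)
    (φ μ : Amb n → ℝ) : Prop where
  smooth : ∀ x ∈ N ∩ Metric.ball 0 ρ, ContDiffAt ℝ ∞ φ x
  continuousOn : ContinuousOn φ (N ∩ Metric.closedBall 0 ρ)
  pos : ∀ x ∈ N ∩ Metric.ball 0 ρ, 0 < φ x
  locallyConstant : ∀ x ∈ N ∩ Metric.ball 0 ρ, ∀ᶠ y in 𝓝[N] x, μ y = μ x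
  eigen : ∀ x ∈ N ∩ Metric.ball 0 ρ, jacobiOp ν φ x + μ x * φ x = 0
  boundary : ∀ x ∈ N ∩ Metric.sphere 0 ρ, φ x = 0

/-- The welded height function: `f` for `|𝐱| ≤ R`, `min {f, h}` for `R < |𝐱| ≤ 2R`, and the
constant `h` for `|𝐱| > 2R`. -/
def welded (f : Amb n → ℝ) (h R : ℝ) (x : Amb n) : ℝ :=
  if ‖x‖ ≤ R then f x else if ‖x‖ ≤ 2 * R then min (f x) h else h

/-- The flow `X : U × (a, b] → ℝⁿ⁺¹` touches the graph `{𝐱 + g(𝐱) ν(𝐱) : 𝐱 ∈ N}` at the time `b`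
from below with respect to `ν`, at the point over `x₀ ∈ N` and with parameter `z₀ ∈ U`:
`X(z₀, b)` is the point of the graph over `x₀`, and for parameters near `z₀` and times before and
near `b` the flow lies weakly below the graph, in the coordinates `(𝐱, y) ↦ 𝐱 + y ν(𝐱)` near
`(x₀, g(x₀))`. -/
def TouchesFromBelow (N : Set (Amb n)) (ν : Amb n → Amb n) (g : Amb n → ℝ)
    (U : Set (Par n)) (a b : ℝ) (X : Par n → ℝ → Amb n) (z₀ : Par n) (x₀ : Amb n) : Prop :=
  X z₀ b = x₀ + g x₀ • ν x₀ ∧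
  ∀ δ > 0, ∀ᶠ q in 𝓝[U ×ˢ Set.Ioc a b] (z₀, b),
    ∃ x ∈ N, ‖x - x₀‖ < δ ∧ ∃ y : ℝ, |y - g x₀| < δ ∧ y ≤ g x ∧ X q.1 q.2 = x + y • ν x

/-- The static normal graph of `g` over `N` is a supersolution of the rescaled mean curvature flow:
the graph is admissible (`|g| |A| ≤ η < 1` on `N`), and no rescaled mean curvature flow touches it
from below. -/
structure IsStaticSupersolution (N : Set (Amb n)) (ν : Amb n → Amb n) (g : Amb n → ℝ) :
    Prop where
  admissible : ∃ η < 1, ∀ x ∈ N, |g x| * Real.sqrt (sqNormA ν x) ≤ η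
  not_touches : ∀ (U : Set (Par n)) (a b : ℝ) (X : Par n → ℝ → Amb n), IsRescaledMCF U a b X →
    ∀ z₀ ∈ U, ∀ x₀ ∈ N, ¬ TouchesFromBelow N ν g U a b X z₀ x₀

end Hypersurfaces

end ExpanderBarrier

end

open ExpanderBarrier

/-! The function `welded` is locally the smaller of two strict barriers or equal to one of them, and
a minimum of barriers is a barrier: a flow lying below the minimum lies below whichever piece takes
the value at the touching point (`NoTouchAt.mono`, `noTouchAt_welded`).

Inner barrier. As `L v = 0`, the function `f = v + α φ` satisfies `L f = -α μ φ`, which is negative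
once `μ > 0` (`eigenvalue_pos`). The weighted mean curvature of the graph of `s f` over an expander
vanishes at `s = 0` and has `s`-derivative `L f`, so on a compact set the graphs are strict barriers
for all small `s > 0` (`exists_forall_noTouchAt_smul`).

Outer barrier. For a constant, `L 1 = |A|² - 1/2`. Since `|A| → 0` along an asymptotically conical
end (`exists_forall_sqNormA_lt`), parallel hypersurfaces at small positive distance are barriers
outside a large ball (`noTouchAt_const`).

Welding. As `v` grows like `r`, it gains about `R` between radius `R` and radius `2R`. For `R` large
and `α` small this beats the error terms, so `f ≥ h` on the sphere of radius `2R`, where the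
function switches to the constant `h`.

Every barrier statement reduces to `not_touches_level_set`, applied to `ψ = Y - G ∘ X`, where `X`
and `Y` are the foot point and the signed height in Fermi coordinates of the expander. The gradient
of `Y` is `ν ∘ X` and its Hessian is the derivative of `ν ∘ X`, so the condition on `ψ` becomes
explicit. -/

namespace ExpanderBarrier

/-! ### Second derivatives of compositions and at maxima. -/

section Calculus

variable {E F : Type*} [NormedAddCommGroup E] [NormedSpace ℝ E] [NormedAddCommGroup F]
  [NormedSpace ℝ F]

/-- The first derivative of a `C²` function is differentiable. -/
lemma differentiableAt_fderiv_of_contDiffAt {f : E → F} {x : E} (hf : ContDiffAt ℝ 2 f x) :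
    DifferentiableAt ℝ (fderiv ℝ f) x :=
  (hf.fderiv_right (m := 1) (by norm_num)).differentiableAt one_ne_zero

/-- The second derivative of a composition. -/
lemma fderiv_fderiv_comp_apply {G : Type*} [NormedAddCommGroup G] [NormedSpace ℝ G]
    {f : F → G} {Y : E → F} {z : E} (hf : ContDiffAt ℝ 2 f (Y z)) (hY : ContDiffAt ℝ 2 Y z)
    (ζ ζ' : E) :
    fderiv ℝ (fderiv ℝ (fun y => f (Y y))) z ζ ζ' =
      fderiv ℝ (fderiv ℝ f) (Y z) (fderiv ℝ Y z ζ) (fderiv ℝ Y z ζ') +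
        fderiv ℝ f (Y z) (fderiv ℝ (fderiv ℝ Y) z ζ ζ') := by
  have h1 : fderiv ℝ (fun y => f (Y y)) =ᶠ[𝓝 z]
      fun y => (fderiv ℝ f (Y y)).comp (fderiv ℝ Y y) := by
    filter_upwards [hY.eventually (by simp), hY.continuousAt.eventually (hf.eventually (by simp))]
      with y hy hy'
    exact fderiv_comp y (hy'.differentiableAt two_ne_zero) (hy.differentiableAt two_ne_zero)
  rw [h1.fderiv_eq]
  have h2 : HasFDerivAt (fun y => fderiv ℝ f (Y y))
      ((fderiv ℝ (fderiv ℝ f) (Y z)).comp (fderiv ℝ Y z)) z :=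
    (differentiableAt_fderiv_of_contDiffAt hf).hasFDerivAt.comp z
      (hY.differentiableAt two_ne_zero).hasFDerivAt
  have h3 := h2.clm_comp (differentiableAt_fderiv_of_contDiffAt hY).hasFDerivAt
  rw [h3.fderiv]
  simp [add_comm]

/-- The second derivative at a local maximum is nonpositive. -/
lemma fderiv_fderiv_nonpos_of_isLocalMax {φ : E → ℝ} {z : E} (hφ : ContDiffAt ℝ 2 φ z)
    (hmax : IsLocalMax φ z) (ζ : E) : fderiv ℝ (fderiv ℝ φ) z ζ ζ ≤ 0 := by
  set c : ℝ → ℝ := fun t => φ (z + t • ζ) with hc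
  have hl : ∀ t, HasDerivAt (fun t : ℝ => z + t • ζ) ζ t := fun t => by
    simpa using ((hasDerivAt_id t).smul_const ζ).const_add z
  have hl0 : Filter.Tendsto (fun t : ℝ => z + t • ζ) (𝓝 0) (𝓝 z) := by
    simpa [ContinuousAt] using (hl 0).continuousAt
  have hd : deriv c =ᶠ[𝓝 0] fun t => fderiv ℝ φ (z + t • ζ) ζ := by
    filter_upwards [hl0.eventually (hφ.eventually (by simp))] with t ht
    exact ((ht.differentiableAt two_ne_zero).hasFDerivAt.comp_hasDerivAt t (hl t)).deriv
  have hdd : HasDerivAt (deriv c) (fderiv ℝ (fderiv ℝ φ) z ζ ζ) 0 := by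
    refine HasDerivAt.congr_of_eventuallyEq ?_ hd
    have h1 : HasFDerivAt (fderiv ℝ φ) (fderiv ℝ (fderiv ℝ φ) z) (z + (0 : ℝ) • ζ) := by
      simpa using (differentiableAt_fderiv_of_contDiffAt hφ).hasFDerivAt
    have h2 : HasDerivAt (fun t : ℝ => fderiv ℝ φ (z + t • ζ)) (fderiv ℝ (fderiv ℝ φ) z ζ) 0 :=
      h1.comp_hasDerivAt 0 (hl 0)
    have h3 := h2.clm_apply (hasDerivAt_const 0 ζ)
    simpa only [map_zero, add_zero] using h3
  have hmax' : IsLocalMax c 0 := by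
    have := hl0.eventually hmax
    simpa [IsLocalMax, IsMaxFilter, hc] using this
  by_contra hpos
  push Not at hpos
  -- A positive second derivative would make the maximum also a local minimum, so `c` would be
  -- locally constant with zero second derivative.
  have hmin : IsLocalMin c 0 :=
    isLocalMin_of_deriv_deriv_pos (by rw [hdd.deriv]; exact hpos) hmax'.deriv_eq_zero
      (by
        have : ContinuousAt φ (z + (0 : ℝ) • ζ) := by simpa using hφ.continuousAt
        exact ContinuousAt.comp (f := fun t : ℝ => z + t • ζ) this (hl 0).continuousAt)
  have hconst : c =ᶠ[𝓝 0] fun _ => c 0 := by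
    filter_upwards [hmax', hmin] with t h1 h2 using le_antisymm h1 h2
  have : deriv c =ᶠ[𝓝 0] fun _ => 0 := by
    simpa using hconst.deriv
  have h0 := this.deriv_eq
  rw [hdd.deriv] at h0
  simp at h0
  linarith

end Calculus

/-! ### Traces over hyperplanes and the geometric maximum principle. -/

variable {n : ℕ}

lemma inner_single_left (w : Amb n) (k : Fin (n + 1)) :
    inner ℝ (EuclideanSpace.single k (1 : ℝ)) w = w k := by
  simp [EuclideanSpace.inner_single_left]

lemma sum_smul_single {m : ℕ} (w : EuclideanSpace ℝ (Fin m)) :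
    ∑ k, w k • EuclideanSpace.single k (1 : ℝ) = w := by
  ext i
  simp [Finset.sum_apply, Pi.single_apply]

lemma bilin_apply_eq_sum {m : ℕ} {V : Type*} [NormedAddCommGroup V] [NormedSpace ℝ V]
    (B : EuclideanSpace ℝ (Fin m) →L[ℝ] EuclideanSpace ℝ (Fin m) →L[ℝ] V)
    (w : EuclideanSpace ℝ (Fin m)) :
    B w w = ∑ i, ∑ j, (w i * w j) • B (EuclideanSpace.single i 1) (EuclideanSpace.single j 1) := by
  have h : B w w = ∑ i, w i • B (EuclideanSpace.single i 1) w := by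
    conv_lhs => enter [1]; rw [← sum_smul_single w, map_sum]
    simp only [map_smul, FunLike.coe_sum, Finset.sum_apply]
    rfl
  rw [h]
  refine Finset.sum_congr rfl fun i _ => ?_
  conv_lhs => enter [2, 2]; rw [← sum_smul_single w]
  simp only [map_sum, map_smul, Finset.smul_sum, smul_smul]

/-- Trace of a bilinear form over the orthogonal complement of `e`. -/
lemma sum_bilin_proj (B : Amb n →L[ℝ] Amb n →L[ℝ] ℝ) (e : Amb n) (he : e ≠ 0) :
    ∑ k, B (EuclideanSpace.single k 1 - (e k / ‖e‖ ^ 2) • e)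
        (EuclideanSpace.single k 1 - (e k / ‖e‖ ^ 2) • e) =
      ∑ k, B (EuclideanSpace.single k 1) (EuclideanSpace.single k 1) - B e e / ‖e‖ ^ 2 := by
  have h1 : ∑ k, e k * B e (EuclideanSpace.single k 1) = B e e := by
    conv_rhs => rw [← sum_smul_single e]
    rw [map_sum]
    rw [sum_smul_single e]
    simp
  have h2 : ∑ k, e k * B (EuclideanSpace.single k 1) e = B e e := by
    have : B e e = B (∑ k, e k • EuclideanSpace.single k 1) e := by rw [sum_smul_single]
    rw [this]
    simp
  have h3 : ∑ k, e k ^ 2 = ‖e‖ ^ 2 := by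
    rw [EuclideanSpace.norm_sq_eq]; simp
  have hne : ‖e‖ ^ 2 ≠ 0 := by positivity
  simp only [map_sub, map_smul, sub_apply, smul_apply,
    smul_eq_mul]
  have : ∀ k, B (EuclideanSpace.single k 1) (EuclideanSpace.single k 1) -
        e k / ‖e‖ ^ 2 * B e (EuclideanSpace.single k 1) -
        e k / ‖e‖ ^ 2 * (B (EuclideanSpace.single k 1) e - e k / ‖e‖ ^ 2 * B e e) =
      B (EuclideanSpace.single k 1) (EuclideanSpace.single k 1) -
        (e k * B e (EuclideanSpace.single k 1)) / ‖e‖ ^ 2 -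
        (e k * B (EuclideanSpace.single k 1) e) / ‖e‖ ^ 2 +
        e k ^ 2 * (B e e / (‖e‖ ^ 2) ^ 2) := by
    intro k; field_simp; ring
  simp only [this, Finset.sum_add_distrib, Finset.sum_sub_distrib, ← Finset.sum_div,
    ← Finset.sum_mul, h1, h2, h3]
  field_simp
  ring

/-- The range of an injective linear map `ℝⁿ → ℝⁿ⁺¹` is the orthogonal complement of any of its
normal vectors. -/
lemma range_eq_orthogonal {D : Par n →L[ℝ] Amb n} (hD : Function.Injective D) {e : Amb n}
    (he : e ≠ 0) (horth : ∀ ζ, inner ℝ e (D ζ) = 0) :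
    LinearMap.range D.toLinearMap = (ℝ ∙ e)ᗮ := by
  apply Submodule.eq_of_le_of_finrank_eq
  · rintro _ ⟨ζ, rfl⟩
    rw [Submodule.mem_orthogonal_singleton_iff_inner_right]
    exact horth ζ
  · rw [LinearMap.finrank_range_of_inj hD]
    have := Submodule.finrank_add_finrank_orthogonal (ℝ ∙ e)
    rw [finrank_span_singleton he] at this
    simp at this ⊢
    omega

/-- A frame of `ℝⁿ` which is mapped by `D` to the projections of the standard basis to the range of
`D`, and which resolves the inverse of the Gram matrix. -/
lemma exists_resolving_frame (D : Par n →L[ℝ] Amb n) (hD : Function.Injective D) (e : Amb n)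
    (he : e ≠ 0) (horth : ∀ ζ, inner ℝ e (D ζ) = 0) :
    ∃ ζ : Fin (n + 1) → Par n,
      (∀ k, D (ζ k) = EuclideanSpace.single k 1 - (e k / ‖e‖ ^ 2) • e) ∧
      ∀ i j, ∑ k, ζ k i * ζ k j =
        (Matrix.of fun i j => inner ℝ (D (EuclideanSpace.single i 1))
          (D (EuclideanSpace.single j 1)) : Matrix (Fin n) (Fin n) ℝ)⁻¹ i j := by
  have hne : ‖e‖ ^ 2 ≠ 0 := by positivity
  have hrange := range_eq_orthogonal hD he horth
  have hex : ∀ k, ∃ ζ, D ζ = EuclideanSpace.single k 1 - (e k / ‖e‖ ^ 2) • e := by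
    intro k
    have : EuclideanSpace.single k 1 - (e k / ‖e‖ ^ 2) • e ∈ LinearMap.range D.toLinearMap := by
      rw [hrange, Submodule.mem_orthogonal_singleton_iff_inner_right, inner_sub_right,
        inner_smul_right, real_inner_self_eq_norm_sq, real_inner_comm, inner_single_left]
      field_simp
      ring
    exact this
  choose ζ hζ using hex
  refine ⟨ζ, hζ, fun i j => ?_⟩
  set G : Matrix (Fin n) (Fin n) ℝ := Matrix.of fun i j =>
    inner ℝ (D (EuclideanSpace.single i 1)) (D (EuclideanSpace.single j 1)) with hG
  -- The vectors `ζ k` form a Parseval frame for the metric pulled back by `D`; in coordinates this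
  -- reconstruction formula says that `∑ ζ ζᵀ` inverts the Gram matrix.
  have hrec : ∀ w : Par n, ∑ k, (D w k) • ζ k = w := by
    intro w
    apply hD
    rw [map_sum]
    simp only [map_smul, hζ, smul_sub, Finset.sum_sub_distrib, smul_smul, ← Finset.sum_smul]
    rw [sum_smul_single]
    have : ∑ k, D w k * (e k / ‖e‖ ^ 2) = 0 := by
      have h := horth w
      rw [PiLp.inner_apply] at h
      simp only [← mul_div_assoc, ← Finset.sum_div]
      simp at h
      simp [h]
    rw [this]; simp
  have key : (Matrix.of fun i j => ∑ k, ζ k i * ζ k j : Matrix (Fin n) (Fin n) ℝ) * G = 1 := by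
    ext i l
    have hDl : ∀ k, ∑ j, ζ k j * G j l = D (EuclideanSpace.single l 1) k := by
      intro k
      have h1 : ∑ j, ζ k j * G j l = inner ℝ (D (ζ k)) (D (EuclideanSpace.single l 1)) := by
        have h : ζ k = ∑ j, ζ k j • EuclideanSpace.single j (1 : ℝ) := (sum_smul_single _).symm
        conv_rhs => rw [h, map_sum, sum_inner]
        simp [hG, inner_smul_left]
      rw [h1, hζ, inner_sub_left, inner_smul_left, horth, inner_single_left]
      simp
    rw [Matrix.mul_apply]
    simp only [Matrix.of_apply, Finset.sum_mul]
    rw [Finset.sum_comm]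
    simp only [mul_assoc, ← Finset.mul_sum, hDl]
    have := congrArg (fun w : Par n => w i) (hrec (EuclideanSpace.single l 1))
    simp only [PiLp.single_apply, WithLp.ofLp_sum, Finset.sum_apply, PiLp.smul_apply,
      smul_eq_mul] at this
    rw [Matrix.one_apply, ← this]
    exact Finset.sum_congr rfl fun k _ => mul_comm _ _
  rw [Matrix.inv_eq_left_inv key]
  rfl

/-- Pairing with a vector normal to the immersion does not see the normal projection. -/
lemma inner_normalPart {Y : Par n → Amb n} {z : Par n} {e : Amb n}
    (he : ∀ ζ, inner ℝ e (fderiv ℝ Y z ζ) = 0) (w : Amb n) :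
    inner ℝ e (normalPart Y z w) = inner ℝ e w := by
  have hmem : e ∈ (LinearMap.range (fderiv ℝ Y z).toLinearMap)ᗮ := by
    rw [Submodule.mem_orthogonal']
    rintro _ ⟨ζ, rfl⟩
    exact he ζ
  unfold normalPart
  rw [← Submodule.inner_starProjection_left_eq_right, Submodule.starProjection_eq_self_iff.2 hmem]

/-- The maximum principle at a touching point: a rescaled mean curvature flow cannot touch the zero
set of `ψ` from the side `ψ ≤ 0` at a point where the zero set is strictly mean convex for the
weighted problem. -/
lemma not_touches_level_set {U : Set (Par n)} {a b : ℝ} {X : Par n → ℝ → Amb n}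
    (hX : IsRescaledMCF U a b X) {z₀ : Par n} (hz : z₀ ∈ U) {ψ : Amb n → ℝ} {P e : Amb n}
    (hP : X z₀ b = P) (hψ : ContDiffAt ℝ 2 ψ P) (hψ0 : ψ P = 0)
    (hle : ∀ᶠ q in 𝓝[U ×ˢ Set.Ioc a b] (z₀, b), ψ (X q.1 q.2) ≤ 0)
    (he : e ≠ 0) (hgrad : ∀ w, fderiv ℝ ψ P w = inner ℝ e w)
    (hpos : 0 < ∑ k, fderiv ℝ (fderiv ℝ ψ) P (EuclideanSpace.single k 1)
        (EuclideanSpace.single k 1) - fderiv ℝ (fderiv ℝ ψ) P e e / ‖e‖ ^ 2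
        + 1 / 2 * inner ℝ e P) : False := by
  have hb : b ∈ Set.Ioc a b := ⟨hX.lt, le_rfl⟩
  set Y : Par n → Amb n := fun y => X y b with hY
  have hYs : ContDiffAt ℝ 2 Y z₀ := by
    have h1 : ContDiffOn ℝ ∞ Y U :=
      hX.smooth.comp (f := fun y : Par n => (y, b)) (by fun_prop) fun y hy => ⟨hy, hb⟩
    exact contDiffAt_infty.1 (h1.contDiffAt (hX.isOpen.mem_nhds hz)) 2
  have hmax : IsLocalMax (fun y => ψ (Y y)) z₀ := by
    have h1 : Filter.Tendsto (fun y : Par n => (y, b)) (𝓝 z₀) (𝓝[U ×ˢ Set.Ioc a b] (z₀, b)) := by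
      apply tendsto_nhdsWithin_of_tendsto_nhds_of_eventually_within
      · exact (by fun_prop : Continuous fun y : Par n => (y, b)).tendsto z₀
      · filter_upwards [hX.isOpen.mem_nhds hz] with y hy using ⟨hy, hb⟩
    have := h1.eventually hle
    filter_upwards [this] with y hy
    simpa [hY, hP, hψ0] using hy
  have hψY : ContDiffAt ℝ 2 ψ (Y z₀) := by simpa [hY, hP] using hψ
  have horth : ∀ ζ, inner ℝ e (fderiv ℝ Y z₀ ζ) = 0 := by
    intro ζ
    have h1 := hmax.fderiv_eq_zero
    have h2 : fderiv ℝ (fun y => ψ (Y y)) z₀ = (fderiv ℝ ψ (Y z₀)).comp (fderiv ℝ Y z₀) :=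
      fderiv_comp z₀ (hψY.differentiableAt two_ne_zero) (hYs.differentiableAt two_ne_zero)
    rw [← hgrad, ← hP]
    have := congrArg (fun l => l ζ) (h2.symm.trans h1)
    simpa using this
  obtain ⟨ζ, hζ, hζ'⟩ := exists_resolving_frame (fderiv ℝ Y z₀) (hX.immersion z₀ hz b hb) e he horth
  -- Along `z₀` the value of `ψ` is at most `0` before time `b` and equals `0` at `b`, so its left
  -- derivative is nonnegative.
  have htime : 0 ≤ inner ℝ e (derivWithin (fun σ => X z₀ σ) (Set.Ioc a b) b) := by
    have hd : DifferentiableWithinAt ℝ (fun σ => X z₀ σ) (Set.Ioc a b) b := by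
      have h1 : ContDiffOn ℝ ∞ (fun σ => X z₀ σ) (Set.Ioc a b) :=
        hX.smooth.comp (f := fun σ : ℝ => (z₀, σ)) (by fun_prop) fun y hy => ⟨hz, hy⟩
      exact (h1 b hb).differentiableWithinAt (by simp)
    have h2 : HasDerivWithinAt (fun σ => ψ (X z₀ σ))
        (inner ℝ e (derivWithin (fun σ => X z₀ σ) (Set.Ioc a b) b)) (Set.Ioc a b) b := by
      rw [← hgrad]
      have h3 : HasFDerivAt ψ (fderiv ℝ ψ P) (X z₀ b) := by
        rw [hP]; exact (hψ.differentiableAt two_ne_zero).hasFDerivAt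
      exact h3.comp_hasDerivWithinAt b hd.hasDerivWithinAt
    have h4 := h2.mono (Set.Ioo_subset_Ioc_self)
    have h5 : 𝓝[Set.Ioo a b] b = 𝓝[<] b := nhdsWithin_Ioo_eq_nhdsLT hX.lt
    rw [hasDerivWithinAt_iff_tendsto_slope] at h4
    have h6 : Set.Ioo a b \ {b} = Set.Ioo a b := by
      simp
    rw [h6, h5] at h4
    refine ge_of_tendsto h4 ?_
    have h7 : Filter.Tendsto (fun σ : ℝ => (z₀, σ)) (𝓝[<] b) (𝓝[U ×ˢ Set.Ioc a b] (z₀, b)) := by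
      rw [← h5]
      apply tendsto_nhdsWithin_of_tendsto_nhds_of_eventually_within
      · exact ((by fun_prop : Continuous fun σ : ℝ => (z₀, σ)).tendsto b).mono_left inf_le_left
      · filter_upwards [self_mem_nhdsWithin] with σ hσ using ⟨hz, Set.Ioo_subset_Ioc_self hσ⟩
    filter_upwards [h7.eventually hle, self_mem_nhdsWithin] with σ h8 h9
    rw [slope_def_field, hP, hψ0]
    have h9' : σ < b := h9
    exact div_nonneg_of_nonpos (by linarith) (by linarith)
  have hflow := congrArg (fun w => inner ℝ e w) (hX.flow z₀ hz b hb)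
  simp only [inner_sub_right, inner_smul_right] at hflow
  rw [inner_normalPart horth, inner_normalPart horth] at hflow
  unfold meanCurvatureVector at hflow
  rw [inner_normalPart horth] at hflow
  -- The resolving frame turns the trace with `g^{ij}` into a sum over the ambient basis, to be
  -- matched with the Hessian trace of `ψ`.
  have hH : inner ℝ e (∑ i, ∑ j, (inducedMetric Y z₀)⁻¹ i j •
      fderiv ℝ (fderiv ℝ Y) z₀ (EuclideanSpace.single i 1) (EuclideanSpace.single j 1)) =
      ∑ k, fderiv ℝ ψ P (fderiv ℝ (fderiv ℝ Y) z₀ (ζ k) (ζ k)) := by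
    have h1 : ∀ k, fderiv ℝ ψ P (fderiv ℝ (fderiv ℝ Y) z₀ (ζ k) (ζ k)) =
        ∑ i, ∑ j, ζ k i * ζ k j * fderiv ℝ ψ P (fderiv ℝ (fderiv ℝ Y) z₀
          (EuclideanSpace.single i 1) (EuclideanSpace.single j 1)) := by
      intro k
      rw [bilin_apply_eq_sum]
      simp only [map_sum, map_smul, smul_eq_mul]
    simp only [h1]
    conv_rhs => rw [Finset.sum_comm]
    rw [inner_sum]
    refine Finset.sum_congr rfl fun i _ => ?_
    conv_rhs => rw [Finset.sum_comm]
    rw [inner_sum]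
    refine Finset.sum_congr rfl fun j _ => ?_
    rw [← Finset.sum_mul, hζ' i j, inner_smul_right, ← hgrad]
    rfl
  have hsecond : ∑ k, (fderiv ℝ (fderiv ℝ ψ) P
        (EuclideanSpace.single k 1 - (e k / ‖e‖ ^ 2) • e)
        (EuclideanSpace.single k 1 - (e k / ‖e‖ ^ 2) • e)
      + fderiv ℝ ψ P (fderiv ℝ (fderiv ℝ Y) z₀ (ζ k) (ζ k))) ≤ 0 := by
    refine Finset.sum_nonpos fun k _ => ?_
    have h1 := fderiv_fderiv_nonpos_of_isLocalMax (ContDiffAt.comp z₀ hψY hYs) hmax (ζ k)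
    have h2 := fderiv_fderiv_comp_apply hψY hYs (ζ k) (ζ k)
    rw [hζ k] at h2
    have h3 : Y z₀ = P := hP
    rw [h3] at h2
    rw [← h2]
    exact h1
  rw [Finset.sum_add_distrib, sum_bilin_proj _ e he] at hsecond
  rw [hP] at hflow
  -- By `hsecond` and `hpos` the right side is negative, against `htime`.
  have h10 : inner ℝ e (derivWithin (fun σ => X z₀ σ) (Set.Ioc a b) b) =
      (∑ k, fderiv ℝ ψ P (fderiv ℝ (fderiv ℝ Y) z₀ (ζ k) (ζ k))) - 1 / 2 * inner ℝ e P := by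
    rw [← hH]; exact hflow
  linarith

/-! ### Fermi coordinates of a hypersurface. -/

variable {N : Set (Amb n)} {ν : Amb n → Amb n}

/-- `X` and `Y` are the `C³` coordinates of the normal exponential map `(x, y) ↦ x + y ν(x)` of `N`
near `(x₀, y₀)`. -/
structure FermiAt (N : Set (Amb n)) (ν : Amb n → Amb n) (X : Amb n → Amb n) (Y : Amb n → ℝ)
    (x₀ : Amb n) (y₀ : ℝ) : Prop where
  mem : x₀ ∈ N
  smooth_foot : ContDiffAt ℝ 3 X (x₀ + y₀ • ν x₀)
  smooth_height : ContDiffAt ℝ 3 Y (x₀ + y₀ • ν x₀)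
  left : ∀ᶠ q : Amb n × ℝ in 𝓝 (x₀, y₀), q.1 ∈ N →
    X (q.1 + q.2 • ν q.1) = q.1 ∧ Y (q.1 + q.2 • ν q.1) = q.2
  right : ∀ᶠ P in 𝓝 (x₀ + y₀ • ν x₀), X P ∈ N ∧ X P + Y P • ν (X P) = P

lemma IsOrientedHypersurface.contDiffAt_normal (hν : IsOrientedHypersurface N ν) {x : Amb n}
    (hx : x ∈ N) (k : ℕ) : ContDiffAt ℝ k ν x :=
  contDiffAt_infty.1 (hν.smooth_normal x hx) k

lemma IsOrientedHypersurface.differentiableAt_normal (hν : IsOrientedHypersurface N ν) {x : Amb n}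
    (hx : x ∈ N) : DifferentiableAt ℝ ν x :=
  (hν.contDiffAt_normal hx 1).differentiableAt (by simp)

/-- Fermi coordinates exist where the normal exponential map is nondegenerate. -/
lemma exists_fermiAt_of_injective (hν : IsOrientedHypersurface N ν) {x₀ : Amb n} (hx : x₀ ∈ N)
    (y₀ : ℝ) (hinj : ∀ (ξ : Amb n) (η : ℝ), inner ℝ (ν x₀) ξ = 0 →
      ξ + y₀ • fderiv ℝ ν x₀ ξ + η • ν x₀ = 0 → ξ = 0 ∧ η = 0) :
    ∃ X Y, FermiAt N ν X Y x₀ y₀ := by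
  obtain ⟨F, hF, hFN, hFg⟩ := hν.smooth x₀ hx
  have hF0 : F x₀ = 0 := hFN.self_of_nhds.1 hx
  -- Adjoining the defining function `F` makes the normal exponential map an equidimensional map of
  -- the ambient space times `ℝ`. The inverse function theorem then applies without charts, and `N`
  -- corresponds to second component `0`.
  set A : Amb n × ℝ → Amb n × ℝ := fun q => (q.1 + q.2 • ν q.1, F q.1) with hA
  have hA3 : ContDiffAt ℝ 3 A (x₀, y₀) := by
    have h1 : ContDiffAt ℝ 3 (fun q : Amb n × ℝ => ν q.1) (x₀, y₀) :=
      ContDiffAt.comp (x₀, y₀) (g := ν) (f := Prod.fst) (hν.contDiffAt_normal hx 3) contDiffAt_fst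
    have h2 : ContDiffAt ℝ 3 (fun q : Amb n × ℝ => F q.1) (x₀, y₀) :=
      ContDiffAt.comp (x₀, y₀) (g := F) (f := Prod.fst) (contDiff_infty.1 hF 3).contDiffAt
        contDiffAt_fst
    exact (contDiffAt_fst.add (contDiffAt_snd.smul h1)).prodMk h2
  have hA' : HasFDerivAt A ((ContinuousLinearMap.fst ℝ (Amb n) ℝ +
      (y₀ • (fderiv ℝ ν x₀).comp (ContinuousLinearMap.fst ℝ (Amb n) ℝ) +
        (ContinuousLinearMap.snd ℝ (Amb n) ℝ).smulRight (ν x₀))).prod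
      ((fderiv ℝ F x₀).comp (ContinuousLinearMap.fst ℝ (Amb n) ℝ))) (x₀, y₀) := by
    have h1 : HasFDerivAt (fun q : Amb n × ℝ => ν q.1)
        ((fderiv ℝ ν x₀).comp (ContinuousLinearMap.fst ℝ (Amb n) ℝ)) (x₀, y₀) :=
      HasFDerivAt.comp (x₀, y₀) (g := ν) (f := Prod.fst)
        (hν.differentiableAt_normal hx).hasFDerivAt hasFDerivAt_fst
    have h2 : HasFDerivAt (fun q : Amb n × ℝ => F q.1)
        ((fderiv ℝ F x₀).comp (ContinuousLinearMap.fst ℝ (Amb n) ℝ)) (x₀, y₀) :=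
      HasFDerivAt.comp (x₀, y₀) (g := F) (f := Prod.fst)
        (hFg.differentiableAt).hasFDerivAt hasFDerivAt_fst
    exact (hasFDerivAt_fst.add (hasFDerivAt_snd.smul h1)).prodMk h2
  set A' := ((ContinuousLinearMap.fst ℝ (Amb n) ℝ +
      (y₀ • (fderiv ℝ ν x₀).comp (ContinuousLinearMap.fst ℝ (Amb n) ℝ) +
        (ContinuousLinearMap.snd ℝ (Amb n) ℝ).smulRight (ν x₀))).prod
      ((fderiv ℝ F x₀).comp (ContinuousLinearMap.fst ℝ (Amb n) ℝ))) with hA'def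
  have hAinj : Function.Injective A' := by
    rw [injective_iff_map_eq_zero]
    rintro ⟨ξ, η⟩ h
    simp only [hA'def, ContinuousLinearMap.prod_apply, Prod.mk_eq_zero] at h
    obtain ⟨h1, h2⟩ := h
    have h3 : inner ℝ (ν x₀) ξ = 0 := by
      rw [← hFg.fderiv_apply]; simpa using h2
    have h4 := hinj ξ η h3 (by rw [add_assoc]; simpa using h1)
    simp [h4.1, h4.2]
  set Ae : (Amb n × ℝ) ≃L[ℝ] (Amb n × ℝ) :=
    (LinearEquiv.ofInjectiveEndo A'.toLinearMap hAinj).toContinuousLinearEquiv with hAe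
  have hAe' : HasFDerivAt A (Ae : (Amb n × ℝ) →L[ℝ] (Amb n × ℝ)) (x₀, y₀) := by
    convert! hA' using 1
  have h30 : (3 : WithTop ℕ∞) ≠ 0 := by norm_num
  have hstrict := hA3.hasStrictFDerivAt' hAe' h30
  set B := hA3.localInverse hAe' h30 with hB
  have hB3 : ContDiffAt ℝ 3 B (A (x₀, y₀)) := hA3.to_localInverse hAe' h30
  have hAx : A (x₀, y₀) = (x₀ + y₀ • ν x₀, 0) := by simp [hA, hF0]
  have hBA : ∀ᶠ q in 𝓝 (x₀, y₀), B (A q) = q := hstrict.eventually_left_inverse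
  have hAB : ∀ᶠ Q in 𝓝 (A (x₀, y₀)), A (B Q) = Q := hstrict.eventually_right_inverse
  have hB0 : B (A (x₀, y₀)) = (x₀, y₀) := hBA.self_of_nhds
  rw [hAx] at hB3 hAB hB0
  have hι : ContDiffAt ℝ 3 (fun P : Amb n => (P, (0 : ℝ))) (x₀ + y₀ • ν x₀) := by fun_prop
  have hBι : ContDiffAt ℝ 3 (fun P : Amb n => B (P, 0)) (x₀ + y₀ • ν x₀) :=
    ContDiffAt.comp _ (g := B) (f := fun P : Amb n => (P, (0 : ℝ))) hB3 hι
  refine ⟨fun P => (B (P, 0)).1, fun P => (B (P, 0)).2, hx, hBι.fst, hBι.snd, ?_, ?_⟩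
  · have h1 : ∀ᶠ q : Amb n × ℝ in 𝓝 (x₀, y₀), q.1 ∈ N ↔ F q.1 = 0 :=
      (continuous_fst.tendsto (x₀, y₀)).eventually hFN
    filter_upwards [hBA, h1] with q h2 h3 h4
    have : A q = (q.1 + q.2 • ν q.1, 0) := by simp [hA, h3.1 h4]
    rw [this] at h2
    simp [h2]
  · have h1 : Filter.Tendsto (fun P : Amb n => B (P, 0)) (𝓝 (x₀ + y₀ • ν x₀)) (𝓝 (x₀, y₀)) := by
      have := hBι.continuousAt
      simpa only [ContinuousAt, hB0] using this
    have h2 := h1.eventually ((continuous_fst.tendsto (x₀, y₀)).eventually hFN)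
    filter_upwards [h2, hι.continuousAt.eventually hAB] with P h3 h4
    have h5 := Prod.ext_iff.1 h4
    simp only [hA] at h5
    exact ⟨h3.2 h5.2, h5.1⟩

lemma exists_fermiAt_zero (hν : IsOrientedHypersurface N ν) {x₀ : Amb n} (hx : x₀ ∈ N) :
    ∃ X Y, FermiAt N ν X Y x₀ 0 := by
  refine exists_fermiAt_of_injective hν hx 0 fun ξ η h1 h2 => ?_
  have h3 : η = 0 := by
    have := congrArg (fun w => inner ℝ (ν x₀) w) h2
    simpa [inner_add_right, inner_smul_right, h1, hν.norm_normal x₀ hx] using this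
  subst h3
  simpa using h2

namespace FermiAt

variable {X : Amb n → Amb n} {Y : Amb n → ℝ} {x₀ : Amb n} {y₀ : ℝ}

lemma foot_eq (h : FermiAt N ν X Y x₀ y₀) : X (x₀ + y₀ • ν x₀) = x₀ :=
  (h.left.self_of_nhds h.mem).1

lemma height_eq (h : FermiAt N ν X Y x₀ y₀) : Y (x₀ + y₀ • ν x₀) = y₀ :=
  (h.left.self_of_nhds h.mem).2

/-- The same `X` and `Y` serve all nearby base points, so pointwise derivative formulas hold on a
neighbourhood and can be differentiated again. -/
lemma eventually_of_mem (hν : IsOrientedHypersurface N ν) (h : FermiAt N ν X Y x₀ y₀) :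
    ∀ᶠ q : Amb n × ℝ in 𝓝 (x₀, y₀), q.1 ∈ N → FermiAt N ν X Y q.1 q.2 := by
  have hc : Filter.Tendsto (fun q : Amb n × ℝ => q.1 + q.2 • ν q.1) (𝓝 (x₀, y₀))
      (𝓝 (x₀ + y₀ • ν x₀)) := by
    have h1 : ContinuousAt (fun q : Amb n × ℝ => ν q.1) (x₀, y₀) :=
      ContinuousAt.comp (x := (x₀, y₀)) (g := ν) (f := Prod.fst)
        (hν.contDiffAt_normal h.mem 0).continuousAt continuousAt_fst
    exact (continuousAt_fst.add (continuousAt_snd.smul h1))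
  filter_upwards [hc.eventually (h.smooth_foot.eventually (by norm_num)),
    hc.eventually (h.smooth_height.eventually (by norm_num)),
    hc.eventually h.right.eventually_nhds, h.left.eventually_nhds] with q h1 h2 h3 h4 h5
  exact ⟨h5, h1, h2, h4, h3⟩

lemma eventually (hν : IsOrientedHypersurface N ν) (h : FermiAt N ν X Y x₀ y₀) :
    ∀ᶠ P in 𝓝 (x₀ + y₀ • ν x₀), FermiAt N ν X Y (X P) (Y P) ∧ X P + Y P • ν (X P) = P := by
  have hc : Filter.Tendsto (fun P => (X P, Y P)) (𝓝 (x₀ + y₀ • ν x₀)) (𝓝 (x₀, y₀)) := by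
    have := h.smooth_foot.continuousAt.prodMk h.smooth_height.continuousAt
    simpa only [ContinuousAt, h.foot_eq, h.height_eq] using this
  filter_upwards [hc.eventually (h.eventually_of_mem hν), h.right] with P h1 h2
  exact ⟨h1 h2.1, h2.2⟩

lemma hasFDerivAt_foot (h : FermiAt N ν X Y x₀ y₀) :
    HasFDerivAt X (fderiv ℝ X (x₀ + y₀ • ν x₀)) (x₀ + y₀ • ν x₀) :=
  (h.smooth_foot.differentiableAt (by norm_num)).hasFDerivAt

lemma hasFDerivAt_height (h : FermiAt N ν X Y x₀ y₀) :
    HasFDerivAt Y (fderiv ℝ Y (x₀ + y₀ • ν x₀)) (x₀ + y₀ • ν x₀) :=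
  (h.smooth_height.differentiableAt (by norm_num)).hasFDerivAt

lemma contDiffAt_normal (hν : IsOrientedHypersurface N ν) (h : FermiAt N ν X Y x₀ y₀) :
    ContDiffAt ℝ 3 (fun P => ν (X P)) (x₀ + y₀ • ν x₀) := by
  refine ContDiffAt.comp _ (g := ν) (f := X) ?_ h.smooth_foot
  rw [h.foot_eq]
  exact hν.contDiffAt_normal h.mem 3

lemma hasFDerivAt_normal (hν : IsOrientedHypersurface N ν) (h : FermiAt N ν X Y x₀ y₀) :
    HasFDerivAt (fun P => ν (X P)) (fderiv ℝ (fun P => ν (X P)) (x₀ + y₀ • ν x₀))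
      (x₀ + y₀ • ν x₀) :=
  ((h.contDiffAt_normal hν).differentiableAt (by norm_num)).hasFDerivAt

lemma fderiv_normal_apply (hν : IsOrientedHypersurface N ν) (h : FermiAt N ν X Y x₀ y₀)
    (e : Amb n) : fderiv ℝ (fun P => ν (X P)) (x₀ + y₀ • ν x₀) e =
      fderiv ℝ ν x₀ (fderiv ℝ X (x₀ + y₀ • ν x₀) e) := by
  have h1 : HasFDerivAt ν (fderiv ℝ ν x₀) (X (x₀ + y₀ • ν x₀)) := by
    rw [h.foot_eq]; exact (hν.differentiableAt_normal h.mem).hasFDerivAt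
  have h2 := (h1.comp _ h.hasFDerivAt_foot).fderiv
  have h3 : (ν ∘ X) = fun P => ν (X P) := rfl
  rw [h3] at h2
  rw [h2]; rfl

/-- The foot point stays in `N`, so a local defining function vanishes along `X`; its gradient at
`x₀` is `ν x₀`. -/
lemma inner_normal_fderiv_foot (hν : IsOrientedHypersurface N ν) (h : FermiAt N ν X Y x₀ y₀)
    (e : Amb n) : inner ℝ (ν x₀) (fderiv ℝ X (x₀ + y₀ • ν x₀) e) = 0 := by
  obtain ⟨F, -, hFN, hFg⟩ := hν.smooth x₀ h.mem
  have h1 : HasFDerivAt F (fderiv ℝ F x₀) (X (x₀ + y₀ • ν x₀)) := by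
    rw [h.foot_eq]; exact hFg.differentiableAt.hasFDerivAt
  have h2 := h1.comp _ h.hasFDerivAt_foot
  have h3 : (F ∘ X) =ᶠ[𝓝 (x₀ + y₀ • ν x₀)] fun _ => 0 := by
    have hc : Filter.Tendsto X (𝓝 (x₀ + y₀ • ν x₀)) (𝓝 x₀) := by
      have := h.smooth_foot.continuousAt
      unfold ContinuousAt at this
      rwa [h.foot_eq] at this
    filter_upwards [hc.eventually hFN, h.right] with P h4 h5 using h4.1 h5.1
  have h4 := h2.fderiv.symm.trans h3.fderiv_eq
  rw [← hFg.fderiv_apply]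
  simpa using congrArg (fun l => l e) h4

lemma inner_normal_fderiv_normal (hν : IsOrientedHypersurface N ν) (h : FermiAt N ν X Y x₀ y₀)
    (e : Amb n) : inner ℝ (ν x₀) (fderiv ℝ (fun P => ν (X P)) (x₀ + y₀ • ν x₀) e) = 0 := by
  have h1 := ((h.hasFDerivAt_normal hν).inner ℝ (h.hasFDerivAt_normal hν)).fderiv
  have h2 : (fun P => inner ℝ (ν (X P)) (ν (X P))) =ᶠ[𝓝 (x₀ + y₀ • ν x₀)] fun _ => (1 : ℝ) := by
    filter_upwards [h.right] with P h5
    rw [real_inner_self_eq_norm_sq, hν.norm_normal _ h5.1]; norm_num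
  rw [h2.fderiv_eq] at h1
  have h3 := congrArg (fun l => l e) h1
  simp only [h.foot_eq, fderiv_fun_const, Pi.zero_apply, zero_apply,
    ContinuousLinearMap.comp_apply, ContinuousLinearMap.prod_apply, fderivInnerCLM_apply] at h3
  rw [real_inner_comm (ν x₀)] at h3
  linarith

/-- Derivative of the identity `X P + Y P • ν (X P) = P`. Its normal and tangential components give
the derivatives of `Y` and `X`. -/
lemma decomposition (hν : IsOrientedHypersurface N ν) (h : FermiAt N ν X Y x₀ y₀) (e : Amb n) :
    fderiv ℝ X (x₀ + y₀ • ν x₀) e + (fderiv ℝ Y (x₀ + y₀ • ν x₀) e • ν x₀ +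
      y₀ • fderiv ℝ (fun P => ν (X P)) (x₀ + y₀ • ν x₀) e) = e := by
  have h1 := (h.hasFDerivAt_foot.add (h.hasFDerivAt_height.smul (h.hasFDerivAt_normal hν))).fderiv
  have h2 : (X + Y • fun P => ν (X P)) =ᶠ[𝓝 (x₀ + y₀ • ν x₀)] id := by
    filter_upwards [h.right] with P h5 using h5.2
  rw [h2.fderiv_eq] at h1
  have h3 := congrArg (fun l => l e) h1
  simp [h.foot_eq, h.height_eq] at h3
  rw [add_comm (_ • ν x₀)]
  exact h3.symm

lemma fderiv_height_apply (hν : IsOrientedHypersurface N ν) (h : FermiAt N ν X Y x₀ y₀)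
    (e : Amb n) : fderiv ℝ Y (x₀ + y₀ • ν x₀) e = inner ℝ (ν x₀) e := by
  conv_rhs => rw [← h.decomposition hν e]
  simp [inner_add_right, inner_smul_right, h.inner_normal_fderiv_foot hν,
    h.inner_normal_fderiv_normal hν, hν.norm_normal _ h.mem]

lemma fderiv_foot_apply (hν : IsOrientedHypersurface N ν) (h : FermiAt N ν X Y x₀ y₀)
    (e : Amb n) : fderiv ℝ X (x₀ + y₀ • ν x₀) e =
      e - inner ℝ (ν x₀) e • ν x₀ - y₀ • fderiv ℝ (fun P => ν (X P)) (x₀ + y₀ • ν x₀) e := by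
  have := h.decomposition hν e
  rw [h.fderiv_height_apply hν] at this
  conv_rhs => enter [1, 1]; rw [← this]
  abel

lemma fderiv_fderiv_height_apply (hν : IsOrientedHypersurface N ν) (h : FermiAt N ν X Y x₀ y₀)
    (e e' : Amb n) : fderiv ℝ (fderiv ℝ Y) (x₀ + y₀ • ν x₀) e e' =
      inner ℝ (fderiv ℝ (fun P => ν (X P)) (x₀ + y₀ • ν x₀) e) e' := by
  have h1 : fderiv ℝ Y =ᶠ[𝓝 (x₀ + y₀ • ν x₀)] fun P => innerSL ℝ (ν (X P)) := by
    filter_upwards [h.eventually hν] with P hP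
    ext w
    have := hP.1.fderiv_height_apply hν w
    rw [hP.2] at this
    simpa using this
  rw [h1.fderiv_eq]
  have h2 := ((innerSL ℝ).hasFDerivAt.comp _ (h.hasFDerivAt_normal hν)).fderiv
  have h3 : ((innerSL ℝ) ∘ fun P => ν (X P)) = fun P => innerSL ℝ (ν (X P)) := rfl
  rw [h3] at h2
  rw [h2]
  rfl

/-- The bilinear form is the Hessian of `Y`; this is where self-adjointness of the shape operator
comes from. -/
lemma fderiv_normal_symm (hν : IsOrientedHypersurface N ν) (h : FermiAt N ν X Y x₀ y₀)
    (e e' : Amb n) : inner ℝ (fderiv ℝ (fun P => ν (X P)) (x₀ + y₀ • ν x₀) e) e' =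
      inner ℝ e (fderiv ℝ (fun P => ν (X P)) (x₀ + y₀ • ν x₀) e') := by
  rw [← h.fderiv_fderiv_height_apply hν, real_inner_comm _ e, ← h.fderiv_fderiv_height_apply hν]
  exact (h.smooth_height.isSymmSndFDerivAt (by simp; norm_num)).eq e e'

lemma fderiv_normal_normal (hν : IsOrientedHypersurface N ν) (h : FermiAt N ν X Y x₀ y₀) :
    fderiv ℝ (fun P => ν (X P)) (x₀ + y₀ • ν x₀) (ν x₀) = 0 := by
  refine ext_inner_right ℝ fun w => ?_
  rw [h.fderiv_normal_symm hν, h.inner_normal_fderiv_normal hν, inner_zero_left]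

lemma fderiv_foot_normal (hν : IsOrientedHypersurface N ν) (h : FermiAt N ν X Y x₀ y₀) :
    fderiv ℝ X (x₀ + y₀ • ν x₀) (ν x₀) = 0 := by
  rw [h.fderiv_foot_apply hν, h.fderiv_normal_normal hν]
  simp [hν.norm_normal _ h.mem]

end FermiAt

/-! ### The shape operator -/

lemma tangentPart_of_orthogonal {x w : Amb n} (h : inner ℝ (ν x) w = 0) :
    tangentPart ν x w = w := by simp [tangentPart, h]

lemma IsOrientedHypersurface.inner_normal_tangentPart (hν : IsOrientedHypersurface N ν) {x : Amb n}
    (hx : x ∈ N) (w : Amb n) : inner ℝ (ν x) (tangentPart ν x w) = 0 := by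
  simp [tangentPart, inner_sub_right, inner_smul_right, hν.norm_normal _ hx]

lemma FermiAt.fderiv_foot_zero {X : Amb n → Amb n} {Y : Amb n → ℝ} {x : Amb n}
    (hν : IsOrientedHypersurface N ν) (h : FermiAt N ν X Y x 0) (e : Amb n) :
    fderiv ℝ X x e = tangentPart ν x e := by
  have := h.fderiv_foot_apply hν e
  simpa [tangentPart] using this

lemma FermiAt.fderiv_normal_zero {X : Amb n → Amb n} {Y : Amb n → ℝ} {x : Amb n}
    (hν : IsOrientedHypersurface N ν) (h : FermiAt N ν X Y x 0) (e : Amb n) :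
    fderiv ℝ (fun P => ν (X P)) x e = fderiv ℝ ν x (tangentPart ν x e) := by
  have := h.fderiv_normal_apply hν e
  simp only [zero_smul, add_zero] at this
  rw [this, h.fderiv_foot_zero hν]

lemma IsOrientedHypersurface.shape_symm (hν : IsOrientedHypersurface N ν) {x : Amb n} (hx : x ∈ N)
    {ξ η : Amb n} (hξ : inner ℝ (ν x) ξ = 0) (hη : inner ℝ (ν x) η = 0) :
    inner ℝ (fderiv ℝ ν x ξ) η = inner ℝ ξ (fderiv ℝ ν x η) := by
  obtain ⟨X, Y, h⟩ := exists_fermiAt_zero hν hx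
  have := h.fderiv_normal_symm hν ξ η
  simp only [zero_smul, add_zero] at this
  rwa [h.fderiv_normal_zero hν, h.fderiv_normal_zero hν, tangentPart_of_orthogonal hξ,
    tangentPart_of_orthogonal hη] at this

lemma IsOrientedHypersurface.shape_tangent (hν : IsOrientedHypersurface N ν) {x : Amb n}
    (hx : x ∈ N) {ξ : Amb n} (hξ : inner ℝ (ν x) ξ = 0) :
    inner ℝ (ν x) (fderiv ℝ ν x ξ) = 0 := by
  obtain ⟨X, Y, h⟩ := exists_fermiAt_zero hν hx
  have := h.inner_normal_fderiv_normal hν ξ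
  simp only [zero_smul, add_zero] at this
  rwa [h.fderiv_normal_zero hν, tangentPart_of_orthogonal hξ] at this

lemma sqNormA_nonneg (ν : Amb n → Amb n) (x : Amb n) : 0 ≤ sqNormA ν x :=
  Finset.sum_nonneg fun _ _ => by positivity

/-- The norm of the shape operator is at most `|A|`. -/
lemma norm_shape_le (ν : Amb n → Amb n) {x ξ : Amb n} (hξ : inner ℝ (ν x) ξ = 0) :
    ‖fderiv ℝ ν x ξ‖ ≤ Real.sqrt (sqNormA ν x) * ‖ξ‖ := by
  have h1 : ξ = ∑ i, ξ i • tangentFrame ν x i := by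
    have h2 : ξ = tangentPart ν x (∑ i, ξ i • EuclideanSpace.single i (1 : ℝ)) := by
      rw [sum_smul_single, tangentPart_of_orthogonal hξ]
    conv_lhs => rw [h2]
    simp only [tangentFrame, tangentPart, smul_sub, Finset.sum_sub_distrib, inner_sum,
      Finset.sum_smul, inner_smul_right, smul_smul]
  have h3 : ‖fderiv ℝ ν x ξ‖ ≤ ∑ i, ‖fderiv ℝ ν x (tangentFrame ν x i)‖ * ‖ξ i‖ := by
    conv_lhs => rw [h1, map_sum]
    refine (norm_sum_le _ _).trans (Finset.sum_le_sum fun i _ => ?_)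
    rw [map_smul, norm_smul, mul_comm]
  refine h3.trans ?_
  have h4 := Real.sum_mul_le_sqrt_mul_sqrt Finset.univ
    (fun i => ‖fderiv ℝ ν x (tangentFrame ν x i)‖) (fun i => ‖ξ i‖)
  rw [EuclideanSpace.norm_eq]
  exact h4

/-- Fermi coordinates exist up to the focal distance. -/
lemma exists_fermiAt (hν : IsOrientedHypersurface N ν) {x₀ : Amb n} (hx : x₀ ∈ N) {y₀ : ℝ}
    (hy : |y₀| * Real.sqrt (sqNormA ν x₀) < 1) : ∃ X Y, FermiAt N ν X Y x₀ y₀ := by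
  refine exists_fermiAt_of_injective hν hx y₀ fun ξ η h1 h2 => ?_
  have h3 : η = 0 := by
    have := congrArg (fun w => inner ℝ (ν x₀) w) h2
    simpa [inner_add_right, inner_smul_right, h1, hν.norm_normal x₀ hx,
      hν.shape_tangent hx h1] using this
  subst h3
  simp only [zero_smul, add_zero] at h2
  refine ⟨?_, rfl⟩
  by_contra h0
  -- A nonzero kernel vector would satisfy `‖ξ‖ ≤ |y₀| |A| ‖ξ‖`, which `hy` excludes.
  have h4 : ξ = -(y₀ • fderiv ℝ ν x₀ ξ) := eq_neg_of_add_eq_zero_left h2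
  have h5 : ‖ξ‖ = |y₀| * ‖fderiv ℝ ν x₀ ξ‖ := by
    conv_lhs => rw [h4, norm_neg, norm_smul, Real.norm_eq_abs]
  have h6 := norm_shape_le ν h1
  have h7 : 0 < ‖ξ‖ := norm_pos_iff.2 h0
  have h8 : |y₀| * ‖fderiv ℝ ν x₀ ξ‖ ≤ |y₀| * (Real.sqrt (sqNormA ν x₀) * ‖ξ‖) := by gcongr
  nlinarith

variable {X : Amb n → Amb n} {Y : Amb n → ℝ}

/-! ### The Jacobi operator in Fermi coordinates -/

/-- Obtained by differentiating `fderiv_foot_apply` along `N`: the term with factor `Y` drops out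
because `Y` and its derivative in the direction `e` vanish at `x`. The normal vector that remains
produces the term `𝐇 · Dg` of `laplaceBeltrami`. -/
lemma FermiAt.fderiv_fderiv_foot_zero {x : Amb n} (hν : IsOrientedHypersurface N ν)
    (h : FermiAt N ν X Y x 0) {e : Amb n} (he : inner ℝ (ν x) e = 0) :
    fderiv ℝ (fderiv ℝ X) x e e = -(inner ℝ (fderiv ℝ ν x e) e • ν x) := by
  have hx : x + (0 : ℝ) • ν x = x := by simp
  have hXs : ContDiffAt ℝ 3 X x := by simpa [hx] using h.smooth_foot
  have hms : ContDiffAt ℝ 3 (fun P => ν (X P)) x := by simpa [hx] using h.contDiffAt_normal hν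
  have h1 : HasFDerivAt (fun P => fderiv ℝ X P e) ((fderiv ℝ (fderiv ℝ X) x).flip e) x := by
    have := (differentiableAt_fderiv_of_contDiffAt
      (hXs.of_le (by norm_num))).hasFDerivAt.clm_apply (hasFDerivAt_const e x)
    simpa using this
  have hm : HasFDerivAt (fun P => ν (X P)) (fderiv ℝ (fun P => ν (X P)) x) x :=
    (hms.differentiableAt (by norm_num)).hasFDerivAt
  have hM : HasFDerivAt (fun P => fderiv ℝ (fun P => ν (X P)) P e)
      ((fderiv ℝ (fderiv ℝ (fun P => ν (X P))) x).flip e) x := by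
    have := (differentiableAt_fderiv_of_contDiffAt
      (hms.of_le (by norm_num))).hasFDerivAt.clm_apply (hasFDerivAt_const e x)
    simpa using this
  have hY : HasFDerivAt Y (fderiv ℝ Y x) x := by simpa [hx] using h.hasFDerivAt_height
  have h2 : (fun P => fderiv ℝ X P e) =ᶠ[𝓝 x] fun P =>
      e - inner ℝ (ν (X P)) e • ν (X P) - Y P • fderiv ℝ (fun P => ν (X P)) P e := by
    have := h.eventually hν
    rw [hx] at this
    filter_upwards [this] with P hP
    have := hP.1.fderiv_foot_apply hν e
    rwa [hP.2] at this
  have h3 := ((((hm.inner ℝ (hasFDerivAt_const e x)).smul hm).const_sub e).sub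
    (hY.smul hM)).fderiv
  have h4 := h1.fderiv.symm.trans (h2.fderiv_eq.trans h3)
  have h5 := congrArg (fun l => l e) h4
  have hX0 : X x = x := by simpa [hx] using h.foot_eq
  have hY0 : Y x = 0 := by simpa [hx] using h.height_eq
  have hY1 : fderiv ℝ Y x e = 0 := by simpa [hx, he] using h.fderiv_height_apply hν e
  have hM1 : fderiv ℝ (fun P => ν (X P)) x e = fderiv ℝ ν x e := by
    rw [h.fderiv_normal_zero hν, tangentPart_of_orthogonal he]
  simpa [hX0, hY0, hY1, hM1, he, fderivInnerCLM_apply] using h5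

lemma tangentFrame_eq (ν : Amb n → Amb n) (x : Amb n) (i : Fin (n + 1)) :
    tangentFrame ν x i = EuclideanSpace.single i 1 - ν x i • ν x := by
  rw [tangentFrame, tangentPart, real_inner_comm, inner_single_left]

lemma IsOrientedHypersurface.sum_bilin_tangentFrame (hν : IsOrientedHypersurface N ν) {x : Amb n}
    (hx : x ∈ N) (B : Amb n →L[ℝ] Amb n →L[ℝ] ℝ) :
    ∑ i, B (tangentFrame ν x i) (tangentFrame ν x i) =
      ∑ i, B (EuclideanSpace.single i 1) (EuclideanSpace.single i 1) - B (ν x) (ν x) := by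
  have h1 := hν.norm_normal x hx
  have := sum_bilin_proj B (ν x) (by intro h; simp [h] at h1)
  simpa [tangentFrame_eq, h1] using this

lemma FermiAt.contDiffAt_comp_foot {x : Amb n} {y : ℝ} (h : FermiAt N ν X Y x y) {G : Amb n → ℝ}
    {k : WithTop ℕ∞} (hk : k ≤ 3) (hG : ContDiffAt ℝ k G x) :
    ContDiffAt ℝ k (fun P => G (X P)) (x + y • ν x) := by
  refine ContDiffAt.comp _ (g := G) (f := X) ?_ (h.smooth_foot.of_le hk)
  rwa [h.foot_eq]

lemma FermiAt.fderiv_comp_foot_apply {x : Amb n} {y : ℝ} (h : FermiAt N ν X Y x y) {G : Amb n → ℝ}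
    (hG : DifferentiableAt ℝ G x) (e : Amb n) :
    fderiv ℝ (fun P => G (X P)) (x + y • ν x) e = fderiv ℝ G x (fderiv ℝ X (x + y • ν x) e) := by
  have h1 : HasFDerivAt G (fderiv ℝ G x) (X (x + y • ν x)) := by
    rw [h.foot_eq]; exact hG.hasFDerivAt
  have h2 := (h1.comp _ h.hasFDerivAt_foot).fderiv
  have h3 : (G ∘ X) = fun P => G (X P) := rfl
  rw [h3] at h2
  rw [h2]; rfl

/-- The Laplace–Beltrami operator is the tangential trace of the Hessian of the extension which is
constant along the normals. -/
lemma FermiAt.laplaceBeltrami_eq {x : Amb n} (hν : IsOrientedHypersurface N ν)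
    (h : FermiAt N ν X Y x 0) {G : Amb n → ℝ} (hG : ContDiffAt ℝ 2 G x) :
    laplaceBeltrami ν G x = ∑ i, fderiv ℝ (fderiv ℝ (fun P => G (X P))) x
      (tangentFrame ν x i) (tangentFrame ν x i) := by
  have hx : x + (0 : ℝ) • ν x = x := by simp
  have hX0 : X x = x := by simpa [hx] using h.foot_eq
  have hXs : ContDiffAt ℝ 2 X x := by simpa [hx] using h.smooth_foot.of_le (by norm_num)
  have hortho : ∀ i, inner ℝ (ν x) (tangentFrame ν x i) = 0 := fun i =>
    hν.inner_normal_tangentPart h.mem _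
  have h1 : ∀ i, fderiv ℝ (fderiv ℝ (fun P => G (X P))) x (tangentFrame ν x i)
      (tangentFrame ν x i) = fderiv ℝ (fderiv ℝ G) x (tangentFrame ν x i) (tangentFrame ν x i) -
        inner ℝ (fderiv ℝ ν x (tangentFrame ν x i)) (tangentFrame ν x i) *
          fderiv ℝ G x (ν x) := by
    intro i
    rw [fderiv_fderiv_comp_apply (by rwa [hX0]) hXs, hX0, h.fderiv_fderiv_foot_zero hν (hortho i),
      h.fderiv_foot_zero hν, tangentPart_of_orthogonal (hortho i), map_neg, map_smul]
    simp [sub_eq_add_neg]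
  simp only [h1, Finset.sum_sub_distrib, ← Finset.sum_mul]
  rw [laplaceBeltrami, meanCurvature]
  ring

lemma FermiAt.inner_tangentGradient {x : Amb n} (hν : IsOrientedHypersurface N ν)
    (h : FermiAt N ν X Y x 0) {G : Amb n → ℝ} (hG : DifferentiableAt ℝ G x) (w : Amb n) :
    inner ℝ w (tangentGradient ν G x) = fderiv ℝ (fun P => G (X P)) x w := by
  have h1 := h.fderiv_comp_foot_apply hG w
  simp only [zero_smul, add_zero] at h1
  rw [h1, h.fderiv_foot_zero hν, tangentGradient, tangentPart, tangentPart, inner_sub_right,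
    inner_smul_right, map_sub, map_smul, real_inner_comm, inner_gradient_left, real_inner_comm,
    inner_gradient_left, real_inner_comm, smul_eq_mul, mul_comm]

lemma FermiAt.jacobiOp_eq {x : Amb n} (hν : IsOrientedHypersurface N ν)
    (h : FermiAt N ν X Y x 0) {G : Amb n → ℝ} (hG : ContDiffAt ℝ 2 G x) :
    jacobiOp ν G x = ∑ i, fderiv ℝ (fderiv ℝ (fun P => G (X P))) x
      (tangentFrame ν x i) (tangentFrame ν x i) + 1 / 2 * fderiv ℝ (fun P => G (X P)) x x
        - 1 / 2 * G x + sqNormA ν x * G x := by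
  rw [jacobiOp, h.laplaceBeltrami_eq hν hG,
    h.inner_tangentGradient hν (hG.differentiableAt two_ne_zero)]

/-- The maximum principle for the Jacobi operator at a local maximum with value `0`. -/
lemma jacobiOp_nonpos_of_isLocalMax (hν : IsOrientedHypersurface N ν) {x : Amb n} (hx : x ∈ N)
    {G : Amb n → ℝ} (hG : ContDiffAt ℝ 2 G x) (hG0 : G x = 0)
    (hmax : ∀ᶠ y in 𝓝[N] x, G y ≤ 0) : jacobiOp ν G x ≤ 0 := by
  obtain ⟨X, Y, h⟩ := exists_fermiAt_zero hν hx
  have hx' : x + (0 : ℝ) • ν x = x := by simp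
  have hX0 : X x = x := by simpa [hx'] using h.foot_eq
  have hs : ContDiffAt ℝ 2 (fun P => G (X P)) x := by
    simpa [hx'] using h.contDiffAt_comp_foot (by norm_num) hG
  have hm : IsLocalMax (fun P => G (X P)) x := by
    have hc : Filter.Tendsto X (𝓝 x) (𝓝[N] x) := by
      apply tendsto_nhdsWithin_of_tendsto_nhds_of_eventually_within
      · have := h.smooth_foot.continuousAt
        rw [hx'] at this
        simpa only [ContinuousAt, hX0] using this
      · have := h.right
        rw [hx'] at this
        filter_upwards [this] with P hP using hP.1
    filter_upwards [hc.eventually hmax] with P hP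
    rwa [hX0, hG0]
  rw [h.jacobiOp_eq hν hG, hm.fderiv_eq_zero, hG0]
  have : ∑ i, fderiv ℝ (fderiv ℝ (fun P => G (X P))) x
      (tangentFrame ν x i) (tangentFrame ν x i) ≤ 0 :=
    Finset.sum_nonpos fun i _ => fderiv_fderiv_nonpos_of_isLocalMax hs hm _
  simpa using this

/-! ### Barriers -/

/-- No rescaled mean curvature flow touches the normal graph of `g` from below over `x₀`. -/
def NoTouchAt (N : Set (Amb n)) (ν : Amb n → Amb n) (g : Amb n → ℝ) (x₀ : Amb n) : Prop :=
  ∀ (U : Set (Par n)) (a b : ℝ) (X : Par n → ℝ → Amb n), IsRescaledMCF U a b X →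
    ∀ z₀ ∈ U, ¬ TouchesFromBelow N ν g U a b X z₀ x₀

/-- A flow touching the graph of `g` from below also touches that of `G`, at the same point. This is
what makes minima of barriers barriers. -/
lemma NoTouchAt.mono {g G : Amb n → ℝ} {x₀ : Amb n} (hG : NoTouchAt N ν G x₀)
    (hle : ∀ᶠ x in 𝓝[N] x₀, g x ≤ G x) (heq : g x₀ = G x₀) : NoTouchAt N ν g x₀ := by
  intro U a b Z hZ z₀ hz ht
  refine hG U a b Z hZ z₀ hz ⟨heq ▸ ht.1, fun δ hδ => ?_⟩
  rw [eventually_nhdsWithin_iff, Metric.eventually_nhds_iff] at hle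
  obtain ⟨ε, hε, hle⟩ := hle
  filter_upwards [ht.2 (min δ ε) (lt_min hδ hε)] with q hq
  obtain ⟨x, hxN, hx, y, hy, hyg, hq⟩ := hq
  refine ⟨x, hxN, hx.trans_le (min_le_left _ _), y, ?_, hyg.trans (hle ?_ hxN), hq⟩
  · rw [← heq]; exact hy.trans_le (min_le_left _ _)
  · rw [dist_eq_norm]; exact hx.trans_le (min_le_right _ _)

/-- The weighted mean curvature of the parallel hypersurfaces of an expander. -/
lemma FermiAt.weighted_trace {x₀ : Amb n} {y₀ : ℝ} (hν : IsOrientedHypersurface N ν)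
    (hexp : IsSelfExpander N ν) (h : FermiAt N ν X Y x₀ y₀) :
    ∑ i, inner ℝ (fderiv ℝ (fun P => ν (X P)) (x₀ + y₀ • ν x₀) (EuclideanSpace.single i 1))
        (EuclideanSpace.single i (1 : ℝ)) + 1 / 2 * inner ℝ (ν x₀) (x₀ + y₀ • ν x₀) =
      y₀ * (1 / 2 - ∑ i, inner ℝ (fderiv ℝ ν x₀ (tangentFrame ν x₀ i))
        (fderiv ℝ (fun P => ν (X P)) (x₀ + y₀ • ν x₀) (EuclideanSpace.single i 1))) := by
  set M := fderiv ℝ (fun P => ν (X P)) (x₀ + y₀ • ν x₀) with hM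
  have hortho : ∀ i, inner ℝ (ν x₀) (tangentFrame ν x₀ i) = 0 := fun i =>
    hν.inner_normal_tangentPart h.mem _
  have hMt : ∀ e, inner ℝ (ν x₀) (M e) = 0 := h.inner_normal_fderiv_normal hν
  have key : ∀ ξ, inner ℝ (ν x₀) ξ = 0 → ∀ i, inner ℝ ξ (EuclideanSpace.single i (1 : ℝ)) =
      inner ℝ ξ (tangentFrame ν x₀ i) := by
    intro ξ hξ i
    rw [tangentFrame_eq, inner_sub_right, inner_smul_right, real_inner_comm (ν x₀), hξ]
    ring
  have h1 : ∀ i, inner ℝ (M (EuclideanSpace.single i 1)) (EuclideanSpace.single i (1 : ℝ)) =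
      inner ℝ (fderiv ℝ ν x₀ (tangentFrame ν x₀ i)) (tangentFrame ν x₀ i) -
        y₀ * inner ℝ (fderiv ℝ ν x₀ (tangentFrame ν x₀ i)) (M (EuclideanSpace.single i 1)) := by
    intro i
    -- The resolvent relation for the parallel hypersurface: `M = (1 + y₀ Dν)⁻¹ Dν` on tangent
    -- vectors. One substitution isolates the trace of `Dν`, which the expander equation cancels, so
    -- that the remainder carries a factor `y₀`.
    have h2 : M (EuclideanSpace.single i 1) = fderiv ℝ ν x₀ (tangentFrame ν x₀ i) -
        y₀ • fderiv ℝ ν x₀ (M (EuclideanSpace.single i 1)) := by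
      conv_lhs => rw [hM, h.fderiv_normal_apply hν, h.fderiv_foot_apply hν]
      rw [map_sub, map_smul]
      rfl
    conv_lhs => rw [h2]
    rw [inner_sub_left, inner_smul_left, key _ (hν.shape_tangent h.mem (hortho i)),
      key _ (hν.shape_tangent h.mem (hMt _)), hν.shape_symm h.mem (hMt _) (hortho i),
      real_inner_comm (M _)]
    simp
  have h3 := hexp x₀ h.mem
  rw [meanCurvature] at h3
  simp only [h1, Finset.sum_sub_distrib, ← Finset.mul_sum]
  rw [inner_add_right, inner_smul_right, real_inner_self_eq_norm_sq, hν.norm_normal _ h.mem,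
    real_inner_comm x₀]
  linarith

/-- The graph is the zero set of `ψ = Y - g`, with gradient `e = ν x₀ - w`; `hpos` is the hypothesis
of `not_touches_level_set` rewritten by `weighted_trace`. As `Dν` annihilates and avoids the normal
direction, the curvature term in `e` is quadratic in `w`. -/
lemma FermiAt.noTouchAt {x₀ : Amb n} {G : Amb n → ℝ} (hν : IsOrientedHypersurface N ν)
    (hexp : IsSelfExpander N ν) (h : FermiAt N ν X Y x₀ (G x₀)) (hG : ContDiffAt ℝ 2 G x₀)
    {P e w : Amb n} {g : Amb n → ℝ} (hg : g = fun P => G (X P)) (hP : P = x₀ + G x₀ • ν x₀)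
    (hw : w = gradient g P) (he : e = ν x₀ - w)
    (hpos : 0 < G x₀ * (1 / 2 - ∑ i, inner ℝ (fderiv ℝ ν x₀ (tangentFrame ν x₀ i))
        (fderiv ℝ (fun P => ν (X P)) P (EuclideanSpace.single i 1)))
      - ∑ i, fderiv ℝ (fderiv ℝ g) P (EuclideanSpace.single i 1) (EuclideanSpace.single i 1)
      - (inner ℝ (fderiv ℝ (fun P => ν (X P)) P w) w - fderiv ℝ (fderiv ℝ g) P e e) / ‖e‖ ^ 2
      - 1 / 2 * fderiv ℝ g P P) : NoTouchAt N ν G x₀ := by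
  intro U a b Z hZ z₀ hz ht
  have hgs : ContDiffAt ℝ 2 g P := by
    rw [hg, hP]; exact h.contDiffAt_comp_foot (by norm_num) hG
  have hYs : ContDiffAt ℝ 2 Y P := by rw [hP]; exact h.smooth_height.of_le (by norm_num)
  have hd : fderiv ℝ (fun Q => Y Q - g Q) =ᶠ[𝓝 P] fun Q => fderiv ℝ Y Q - fderiv ℝ g Q := by
    filter_upwards [hgs.eventually (by simp), hYs.eventually (by simp)] with Q h1 h2
    exact fderiv_fun_sub (h2.differentiableAt two_ne_zero) (h1.differentiableAt two_ne_zero)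
  have hdd : fderiv ℝ (fderiv ℝ (fun Q => Y Q - g Q)) P =
      fderiv ℝ (fderiv ℝ Y) P - fderiv ℝ (fderiv ℝ g) P := by
    rw [hd.fderiv_eq]
    exact fderiv_fun_sub (differentiableAt_fderiv_of_contDiffAt hYs)
      (differentiableAt_fderiv_of_contDiffAt hgs)
  have hY2 : ∀ v v', fderiv ℝ (fderiv ℝ Y) P v v' =
      inner ℝ (fderiv ℝ (fun P => ν (X P)) P v) v' := by
    rw [hP]; exact h.fderiv_fderiv_height_apply hν
  have hgw : ∀ v, fderiv ℝ g P v = inner ℝ w v := fun v => by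
    rw [hw, inner_gradient_left]
  have hgrad : ∀ v, fderiv ℝ (fun Q => Y Q - g Q) P v = inner ℝ e v := by
    intro v
    rw [hd.self_of_nhds, sub_apply, hgw, he, inner_sub_left, hP, h.fderiv_height_apply hν]
  have hwν : inner ℝ w (ν x₀) = 0 := by
    rw [← hgw, hg, hP, h.fderiv_comp_foot_apply (hG.differentiableAt two_ne_zero),
      h.fderiv_foot_normal hν, map_zero]
  have he0 : e ≠ 0 := by
    intro h0
    have h1 : inner ℝ e (ν x₀) = 1 := by
      rw [he, inner_sub_left, hwν, real_inner_self_eq_norm_sq, hν.norm_normal _ h.mem]; norm_num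
    simp [h0] at h1
  have hM0 : fderiv ℝ (fun P => ν (X P)) P (ν x₀) = 0 := by
    rw [hP]; exact h.fderiv_normal_normal hν
  have hMν : ∀ v, inner ℝ (fderiv ℝ (fun P => ν (X P)) P v) (ν x₀) = 0 := by
    intro v; rw [hP, real_inner_comm]; exact h.inner_normal_fderiv_normal hν v
  have hMe : inner ℝ (fderiv ℝ (fun P => ν (X P)) P e) e =
      inner ℝ (fderiv ℝ (fun P => ν (X P)) P w) w := by
    rw [he, map_sub, hM0, inner_sub_right, inner_sub_left, inner_sub_left, hMν]
    simp
  have htr := h.weighted_trace hν hexp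
  rw [← hP] at htr
  refine not_touches_level_set hZ hz (ψ := fun Q => Y Q - g Q) (P := P) (e := e)
    (by rw [ht.1, hP]) (hYs.sub hgs) ?_ ?_ he0 hgrad ?_
  · simp [hg, hP, h.height_eq, h.foot_eq]
  · have h1 := h.left
    rw [Metric.eventually_nhds_iff] at h1
    obtain ⟨δ, hδ, h1⟩ := h1
    filter_upwards [ht.2 δ hδ] with q hq
    obtain ⟨x, hxN, hx, y, hy, hyg, hq⟩ := hq
    have h2 := @h1 (x, y) (by
      rw [Prod.dist_eq, max_lt_iff]
      exact ⟨by rw [dist_eq_norm]; exact hx, by rw [Real.dist_eq]; exact hy⟩) hxN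
    simp only at h2
    rw [hq, hg]
    simp only [h2.1, h2.2]
    linarith
  · simp only [hdd, sub_apply, hY2, Finset.sum_sub_distrib]
    rw [hMe]
    have h3 : inner ℝ e P = inner ℝ (ν x₀) P - fderiv ℝ g P P := by
      rw [he, inner_sub_left, hgw]
    rw [h3]
    linarith

/-- Parallel hypersurfaces at positive distance are barriers where `|A|` is small. -/
lemma noTouchAt_const {x₀ : Amb n} (hν : IsOrientedHypersurface N ν)
    (hexp : IsSelfExpander N ν) (hx : x₀ ∈ N) {c : ℝ} (hc : 0 < c)
    (hcA : c * Real.sqrt (sqNormA ν x₀) ≤ 1 / 2) (hA : sqNormA ν x₀ < 1 / 4) :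
    NoTouchAt N ν (fun _ => c) x₀ := by
  obtain ⟨X, Y, h⟩ := exists_fermiAt hν hx (y₀ := c) (by rw [abs_of_pos hc]; linarith)
  refine FermiAt.noTouchAt (G := fun _ => c) hν hexp h contDiffAt_const rfl rfl rfl rfl ?_
  have hg : gradient (fun _ : Amb n => c) (x₀ + c • ν x₀) = 0 := by simp [gradient]
  have hd : fderiv ℝ (fun _ : Amb n => c) = fun _ => 0 := by ext; simp
  simp only [hg, hd, fderiv_fun_const]
  simp only [Pi.zero_apply, zero_apply, map_zero, Finset.sum_const_zero, inner_zero_left,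
    sub_zero, zero_div, mul_zero]
  refine mul_pos hc ?_
  set M := fderiv ℝ (fun P => ν (X P)) (x₀ + c • ν x₀) with hM
  set S := fderiv ℝ ν x₀ with hS
  have hMt : ∀ e, inner ℝ (ν x₀) (M e) = 0 := h.inner_normal_fderiv_normal hν
  -- Since `c |A| ≤ 1/2`, the resolvent relation gives `‖M eᵢ‖ ≤ 2 ‖S τᵢ‖`. The sum is then at most
  -- `2 |A|² < 1/2`, which explains the threshold `1/4`.
  have h1 : ∀ i, inner ℝ (S (tangentFrame ν x₀ i)) (M (EuclideanSpace.single i 1)) ≤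
      2 * ‖S (tangentFrame ν x₀ i)‖ ^ 2 := by
    intro i
    have h2 : M (EuclideanSpace.single i 1) = S (tangentFrame ν x₀ i) -
        c • S (M (EuclideanSpace.single i 1)) := by
      conv_lhs => rw [hM, h.fderiv_normal_apply hν, h.fderiv_foot_apply hν]
      rw [map_sub, map_smul]
      rfl
    have h3 : ‖M (EuclideanSpace.single i 1)‖ ≤ ‖S (tangentFrame ν x₀ i)‖ +
        c * ‖S (M (EuclideanSpace.single i 1))‖ := by
      conv_lhs => rw [h2]
      refine (norm_sub_le _ _).trans ?_
      rw [norm_smul, Real.norm_eq_abs, abs_of_pos hc]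
    have h4 := norm_shape_le ν (hMt (EuclideanSpace.single i 1))
    have h5 : c * ‖S (M (EuclideanSpace.single i 1))‖ ≤
        1 / 2 * ‖M (EuclideanSpace.single i 1)‖ := by
      calc c * ‖S (M (EuclideanSpace.single i 1))‖
          ≤ c * (Real.sqrt (sqNormA ν x₀) * ‖M (EuclideanSpace.single i 1)‖) := by gcongr
        _ = (c * Real.sqrt (sqNormA ν x₀)) * ‖M (EuclideanSpace.single i 1)‖ := by ring
        _ ≤ _ := by gcongr
    have h6 : ‖M (EuclideanSpace.single i 1)‖ ≤ 2 * ‖S (tangentFrame ν x₀ i)‖ := by linarith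
    refine (real_inner_le_norm _ _).trans ?_
    calc ‖S (tangentFrame ν x₀ i)‖ * ‖M (EuclideanSpace.single i 1)‖
        ≤ ‖S (tangentFrame ν x₀ i)‖ * (2 * ‖S (tangentFrame ν x₀ i)‖) := by gcongr
      _ = _ := by ring
  have h7 : ∑ i, inner ℝ (S (tangentFrame ν x₀ i)) (M (EuclideanSpace.single i 1)) ≤
      2 * sqNormA ν x₀ := by
    rw [sqNormA, Finset.mul_sum]
    exact Finset.sum_le_sum fun i _ => h1 i
  linarith

lemma IsOrientedHypersurface.continuousAt_fderiv_normal (hν : IsOrientedHypersurface N ν)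
    {x : Amb n} (hx : x ∈ N) : ContinuousAt (fderiv ℝ ν) x :=
  ((hν.contDiffAt_normal hx 1).fderiv_right (m := 0) (by simp)).continuousAt

lemma IsOrientedHypersurface.continuousAt_tangentFrame (hν : IsOrientedHypersurface N ν)
    {x : Amb n} (hx : x ∈ N) (i : Fin (n + 1)) :
    ContinuousAt (fun x => tangentFrame ν x i) x := by
  have h1 : ContinuousAt ν x := (hν.differentiableAt_normal hx).continuousAt
  unfold tangentFrame tangentPart
  fun_prop

lemma IsOrientedHypersurface.continuousAt_sqNormA (hν : IsOrientedHypersurface N ν)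
    {x : Amb n} (hx : x ∈ N) : ContinuousAt (sqNormA ν) x := by
  unfold sqNormA
  refine tendsto_finsetSum _ fun i _ => ?_
  exact (((hν.continuousAt_fderiv_normal hx).clm_apply
    (hν.continuousAt_tangentFrame hx i)).norm.pow 2)

/-- Graphs of small positive multiples of a strict supersolution of the Jacobi equation are
barriers, locally uniformly. -/
lemma eventually_noTouchAt_smul (hν : IsOrientedHypersurface N ν) (hexp : IsSelfExpander N ν)
    {x₁ : Amb n} (hx : x₁ ∈ N) {f : Amb n → ℝ} (hf : ContDiffAt ℝ 3 f x₁)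
    (hL : jacobiOp ν f x₁ < 0) :
    ∀ᶠ q : ℝ × Amb n in 𝓝 (0, x₁), q.2 ∈ N → 0 < q.1 →
      NoTouchAt N ν (fun x => q.1 * f x) q.2 := by
  obtain ⟨X, Y, h⟩ := exists_fermiAt_zero hν hx
  have hx1 : x₁ + (0 : ℝ) • ν x₁ = x₁ := by simp
  have hX1 : X x₁ = x₁ := by simpa [hx1] using h.foot_eq
  set g : Amb n → ℝ := fun P => f (X P) with hg
  have hgs : ContDiffAt ℝ 3 g x₁ := by
    have := h.contDiffAt_comp_foot le_rfl hf; rwa [hx1] at this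
  have hms : ContDiffAt ℝ 3 (fun P => ν (X P)) x₁ := by
    have := h.contDiffAt_normal hν; rwa [hx1] at this
  have hνc : ContinuousAt (fun q : ℝ × Amb n => ν q.2) (0, x₁) :=
    ContinuousAt.comp (x := ((0 : ℝ), x₁)) (g := ν) (f := Prod.snd)
      (hν.differentiableAt_normal hx).continuousAt continuousAt_snd
  have hfc : ContinuousAt (fun q : ℝ × Amb n => f q.2) (0, x₁) :=
    ContinuousAt.comp (x := ((0 : ℝ), x₁)) (g := f) (f := Prod.snd) hf.continuousAt
      continuousAt_snd
  have hSc : ContinuousAt (fun q : ℝ × Amb n => fderiv ℝ ν q.2) (0, x₁) :=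
    ContinuousAt.comp (x := ((0 : ℝ), x₁)) (g := fderiv ℝ ν) (f := Prod.snd)
      (hν.continuousAt_fderiv_normal hx) continuousAt_snd
  have hτc : ∀ i, ContinuousAt (fun q : ℝ × Amb n => tangentFrame ν q.2 i) (0, x₁) := fun i =>
    ContinuousAt.comp (x := ((0 : ℝ), x₁)) (g := fun x => tangentFrame ν x i) (f := Prod.snd)
      (hν.continuousAt_tangentFrame hx i) continuousAt_snd
  set Φ : ℝ × Amb n → Amb n := fun q => q.2 + (q.1 * f q.2) • ν q.2 with hΦ
  have hΦ0 : Φ (0, x₁) = x₁ := by simp [hΦ]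
  have hΦc : ContinuousAt Φ (0, x₁) :=
    continuousAt_snd.add ((continuousAt_fst.mul hfc).smul hνc)
  have hcomp : ∀ {V : Type} [TopologicalSpace V] {k : Amb n → V}, ContinuousAt k x₁ →
      ContinuousAt (fun q => k (Φ q)) (0, x₁) := fun {V} _ {k} hk =>
    ContinuousAt.comp (x := ((0 : ℝ), x₁)) (g := k) (f := Φ) (by rwa [hΦ0]) hΦc
  have hMc : ContinuousAt (fun q => fderiv ℝ (fun P => ν (X P)) (Φ q)) (0, x₁) :=
    hcomp ((hms.fderiv_right (m := 2) (by norm_num)).continuousAt)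
  have hDc : ContinuousAt (fun q => fderiv ℝ g (Φ q)) (0, x₁) :=
    hcomp ((hgs.fderiv_right (m := 2) (by norm_num)).continuousAt)
  have hD2c : ContinuousAt (fun q => fderiv ℝ (fderiv ℝ g) (Φ q)) (0, x₁) :=
    hcomp (((hgs.fderiv_right (m := 2) (by norm_num)).fderiv_right (m := 1)
      (by norm_num)).continuousAt)
  have hwc : ContinuousAt (fun q => gradient g (Φ q)) (0, x₁) := by
    unfold gradient
    exact (InnerProductSpace.toDual ℝ (Amb n)).symm.continuous.continuousAt.comp hDc
  set e : ℝ × Amb n → Amb n := fun q => ν q.2 - q.1 • gradient g (Φ q) with he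
  have hec : ContinuousAt e (0, x₁) := hνc.sub (continuousAt_fst.smul hwc)
  have he0 : e (0, x₁) = ν x₁ := by simp [he]
  -- The quantity `hpos` of `FermiAt.noTouchAt` for `G = s f`, divided by `s = q.1`. It extends
  -- continuously to `s = 0` with value `-L f`, so positivity persists near `(0, x₁)`.
  set K : ℝ × Amb n → ℝ := fun q =>
    f q.2 * (1 / 2 - ∑ i, inner ℝ (fderiv ℝ ν q.2 (tangentFrame ν q.2 i))
        (fderiv ℝ (fun P => ν (X P)) (Φ q) (EuclideanSpace.single i 1)))
      - ∑ i, fderiv ℝ (fderiv ℝ g) (Φ q) (EuclideanSpace.single i 1) (EuclideanSpace.single i 1)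
      - (q.1 * inner ℝ (fderiv ℝ (fun P => ν (X P)) (Φ q) (gradient g (Φ q)))
          (gradient g (Φ q)) - fderiv ℝ (fderiv ℝ g) (Φ q) (e q) (e q)) / ‖e q‖ ^ 2
      - 1 / 2 * fderiv ℝ g (Φ q) (Φ q) with hK
  have hKc : ContinuousAt K (0, x₁) := by
    refine (((hfc.mul (continuousAt_const.sub ?_)).sub ?_).sub
      (ContinuousAt.div ((continuousAt_fst.mul
        ((hMc.clm_apply hwc).inner hwc)).sub ((hD2c.clm_apply hec).clm_apply hec))
        (hec.norm.pow 2) ?_)).sub (continuousAt_const.mul (hDc.clm_apply hΦc))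
    · exact tendsto_finsetSum _ fun i _ => (hSc.clm_apply (hτc i)).inner
        (hMc.clm_apply continuousAt_const)
    · exact tendsto_finsetSum _ fun i _ => (hD2c.clm_apply continuousAt_const).clm_apply
        continuousAt_const
    · change ‖e (0, x₁)‖ ^ 2 ≠ 0
      rw [he0, hν.norm_normal _ hx]; norm_num
  have hK0 : K (0, x₁) = -jacobiOp ν f x₁ := by
    have h1 : ∀ i, fderiv ℝ (fun P => ν (X P)) x₁ (EuclideanSpace.single i 1) =
        fderiv ℝ ν x₁ (tangentFrame ν x₁ i) := fun i => h.fderiv_normal_zero hν _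
    rw [h.jacobiOp_eq hν (hf.of_le (by norm_num)), hν.sum_bilin_tangentFrame hx]
    simp only [hK, hΦ0, he0, h1, hν.norm_normal _ hx, real_inner_self_eq_norm_sq]
    rw [sqNormA]
    ring
  have hKpos : ∀ᶠ q in 𝓝 ((0 : ℝ), x₁), 0 < K q := by
    refine hKc.eventually (lt_mem_nhds ?_)
    rw [hK0]; linarith
  have hq : Filter.Tendsto (fun q : ℝ × Amb n => (q.2, q.1 * f q.2)) (𝓝 (0, x₁))
      (𝓝 (x₁, 0)) := by
    have := continuousAt_snd.prodMk (continuousAt_fst.mul hfc)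
    simpa [ContinuousAt] using this
  have hdiff : ∀ᶠ q in 𝓝 ((0 : ℝ), x₁), ContDiffAt ℝ 3 g (Φ q) := by
    have h2 : Filter.Tendsto Φ (𝓝 (0, x₁)) (𝓝 x₁) := by
      simpa only [ContinuousAt, hΦ0] using hΦc
    exact h2.eventually (hgs.eventually (by norm_num))
  have hfd : ∀ᶠ q : ℝ × Amb n in 𝓝 ((0 : ℝ), x₁), ContDiffAt ℝ 3 f q.2 :=
    (continuous_snd.tendsto ((0 : ℝ), x₁)).eventually (hf.eventually (by norm_num))
  filter_upwards [hKpos, hq.eventually (h.eventually_of_mem hν), hdiff, hfd] with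
    q h1 h2 h3 h4 hqN hqs
  have h5 := h2 hqN
  have hw : gradient (fun P => q.1 * f (X P)) (Φ q) = q.1 • gradient g (Φ q) := by
    refine ext_inner_right ℝ fun v => ?_
    rw [inner_gradient_left, inner_smul_left, inner_gradient_left,
      fderiv_const_mul (h3.differentiableAt (by norm_num))]
    simp
  have hd2 : fderiv ℝ (fderiv ℝ (fun P => q.1 * f (X P))) (Φ q) =
      q.1 • fderiv ℝ (fderiv ℝ g) (Φ q) := by
    have h6 : fderiv ℝ (fun P => q.1 * f (X P)) =ᶠ[𝓝 (Φ q)] fun P => q.1 • fderiv ℝ g P := by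
      filter_upwards [h3.eventually (by norm_num)] with P hP
      exact fderiv_const_mul (hP.differentiableAt (by norm_num)) _
    rw [h6.fderiv_eq]
    exact fderiv_fun_const_smul (differentiableAt_fderiv_of_contDiffAt
      (h3.of_le (by norm_num))) _
  have hd1 : fderiv ℝ (fun P => q.1 * f (X P)) (Φ q) = q.1 • fderiv ℝ g (Φ q) :=
    fderiv_const_mul (h3.differentiableAt (by norm_num)) _
  refine FermiAt.noTouchAt (G := fun x => q.1 * f x) (P := Φ q) (e := e q) hν hexp h5
    (contDiffAt_const.mul (h4.of_le (by norm_num))) rfl rfl rfl (by rw [hw]) ?_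
  rw [hw, hd1, hd2]
  have h7 : q.1 * K q = q.1 * f q.2 * (1 / 2 - ∑ i, inner ℝ (fderiv ℝ ν q.2 (tangentFrame ν q.2 i))
        (fderiv ℝ (fun P => ν (X P)) (Φ q) (EuclideanSpace.single i 1)))
      - ∑ i, (q.1 • fderiv ℝ (fderiv ℝ g) (Φ q)) (EuclideanSpace.single i 1)
          (EuclideanSpace.single i 1)
      - (inner ℝ (fderiv ℝ (fun P => ν (X P)) (Φ q) (q.1 • gradient g (Φ q)))
          (q.1 • gradient g (Φ q)) - (q.1 • fderiv ℝ (fderiv ℝ g) (Φ q)) (e q) (e q)) / ‖e q‖ ^ 2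
      - 1 / 2 * (q.1 • fderiv ℝ g (Φ q)) (Φ q) := by
    simp only [hK, smul_apply, smul_eq_mul, map_smul, inner_smul_left, inner_smul_right,
      ← Finset.mul_sum, RCLike.conj_to_real]
    ring
  rw [← h7]
  exact mul_pos hqs h1

/-- Graphs of small positive multiples of a strict supersolution of the Jacobi equation over a
compact part of the hypersurface are barriers. -/
lemma exists_forall_noTouchAt_smul (hν : IsOrientedHypersurface N ν) (hexp : IsSelfExpander N ν)
    {C : Set (Amb n)} (hC : IsCompact C) (hCN : C ⊆ N) {f : Amb n → ℝ}
    (hf : ∀ x ∈ C, ContDiffAt ℝ 3 f x) (hL : ∀ x ∈ C, jacobiOp ν f x < 0) :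
    ∃ s₀ > 0, ∀ s ∈ Set.Ioo 0 s₀, ∀ x ∈ C, NoTouchAt N ν (fun x => s * f x) x := by
  have h1 : ∀ᶠ s in 𝓝 (0 : ℝ), ∀ x ∈ C, x ∈ N → 0 < s → NoTouchAt N ν (fun x => s * f x) x :=
    hC.eventually_forall_of_forall_eventually fun x hx =>
      eventually_noTouchAt_smul hν hexp (hCN hx) (hf x hx) (hL x hx)
  rw [Metric.eventually_nhds_iff] at h1
  obtain ⟨s₀, hs₀, h1⟩ := h1
  refine ⟨s₀, hs₀, fun s hs x hx => h1 ?_ x hx (hCN hx) hs.1⟩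
  rw [Real.dist_eq, sub_zero, abs_of_pos hs.1]
  exact hs.2

/-! ### Positivity of the first eigenvalue -/

lemma fderiv_fderiv_add {f g : Amb n → ℝ} {x : Amb n} (hf : ContDiffAt ℝ 2 f x)
    (hg : ContDiffAt ℝ 2 g x) : fderiv ℝ (fderiv ℝ (fun y => f y + g y)) x =
      fderiv ℝ (fderiv ℝ f) x + fderiv ℝ (fderiv ℝ g) x := by
  have h : fderiv ℝ (fun y => f y + g y) =ᶠ[𝓝 x] fun y => fderiv ℝ f y + fderiv ℝ g y := by
    filter_upwards [hf.eventually (by simp), hg.eventually (by simp)] with y h1 h2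
    exact fderiv_fun_add (h1.differentiableAt two_ne_zero) (h2.differentiableAt two_ne_zero)
  rw [h.fderiv_eq]
  exact fderiv_fun_add (differentiableAt_fderiv_of_contDiffAt hf)
    (differentiableAt_fderiv_of_contDiffAt hg)

lemma fderiv_fderiv_const_mul {f : Amb n → ℝ} {x : Amb n} (hf : ContDiffAt ℝ 2 f x) (c : ℝ) :
    fderiv ℝ (fderiv ℝ (fun y => c * f y)) x = c • fderiv ℝ (fderiv ℝ f) x := by
  have h : fderiv ℝ (fun y => c * f y) =ᶠ[𝓝 x] fun y => c • fderiv ℝ f y := by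
    filter_upwards [hf.eventually (by simp)] with y h1
    exact fderiv_const_mul (h1.differentiableAt two_ne_zero) _
  rw [h.fderiv_eq]
  exact fderiv_fun_const_smul (differentiableAt_fderiv_of_contDiffAt hf) _

lemma gradient_add {f g : Amb n → ℝ} {x : Amb n} (hf : DifferentiableAt ℝ f x)
    (hg : DifferentiableAt ℝ g x) :
    gradient (fun y => f y + g y) x = gradient f x + gradient g x := by
  unfold gradient
  rw [fderiv_fun_add hf hg, map_add]

lemma gradient_const_mul {f : Amb n → ℝ} {x : Amb n} (hf : DifferentiableAt ℝ f x) (c : ℝ) :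
    gradient (fun y => c * f y) x = c • gradient f x := by
  unfold gradient
  rw [fderiv_const_mul hf, map_smul]

lemma jacobiOp_add {f g : Amb n → ℝ} {x : Amb n} (hf : ContDiffAt ℝ 2 f x)
    (hg : ContDiffAt ℝ 2 g x) :
    jacobiOp ν (fun y => f y + g y) x = jacobiOp ν f x + jacobiOp ν g x := by
  have hf1 := hf.differentiableAt two_ne_zero
  have hg1 := hg.differentiableAt two_ne_zero
  simp only [jacobiOp, laplaceBeltrami, tangentGradient, tangentPart, fderiv_fderiv_add hf hg,
    gradient_add hf1 hg1, fderiv_fun_add hf1 hg1, add_apply, Finset.sum_add_distrib,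
    inner_add_right, inner_sub_right, inner_smul_right]
  ring

lemma jacobiOp_const_mul {f : Amb n → ℝ} {x : Amb n} (hf : ContDiffAt ℝ 2 f x) (c : ℝ) :
    jacobiOp ν (fun y => c * f y) x = c * jacobiOp ν f x := by
  have hf1 := hf.differentiableAt two_ne_zero
  simp only [jacobiOp, laplaceBeltrami, tangentGradient, tangentPart, fderiv_fderiv_const_mul hf,
    gradient_const_mul hf1, fderiv_const_mul hf1, smul_apply, smul_eq_mul, ← Finset.mul_sum,
    inner_sub_right, inner_smul_right]
  ring

lemma fderiv_norm_sq_eq (x : Amb n) :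
    fderiv ℝ (fun y : Amb n => ‖y‖ ^ 2) x = (2 : ℝ) • innerSL ℝ x := by
  have := (hasStrictFDerivAt_norm_sq x).hasFDerivAt.fderiv
  rw [this]
  ext; simp

/-- The function `|𝐱|²` is a strict subsolution of the Jacobi equation of an expander. -/
lemma jacobiOp_norm_sq_pos (hn : n ≠ 0) (hν : IsOrientedHypersurface N ν)
    (hexp : IsSelfExpander N ν) {x : Amb n} (hx : x ∈ N) :
    0 < jacobiOp ν (fun y => ‖y‖ ^ 2) x := by
  have h1 : fderiv ℝ (fun y : Amb n => ‖y‖ ^ 2) = fun x => (2 : ℝ) • innerSL ℝ x := by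
    ext1 y; exact fderiv_norm_sq_eq y
  have h2 : fderiv ℝ (fderiv ℝ (fun y : Amb n => ‖y‖ ^ 2)) x = (2 : ℝ) • innerSL ℝ := by
    rw [h1]
    exact ((2 : ℝ) • (innerSL ℝ : Amb n →L[ℝ] Amb n →L[ℝ] ℝ)).hasFDerivAt.fderiv
  have h3 : gradient (fun y : Amb n => ‖y‖ ^ 2) x = (2 : ℝ) • x := by
    refine ext_inner_right ℝ fun w => ?_
    rw [inner_gradient_left, fderiv_norm_sq_eq, inner_smul_left]; simp
  have hνx := hν.norm_normal x hx
  have h4 : ∑ i, fderiv ℝ (fderiv ℝ (fun y : Amb n => ‖y‖ ^ 2)) x (tangentFrame ν x i)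
      (tangentFrame ν x i) = 2 * n := by
    have h' : ∀ w, fderiv ℝ (fderiv ℝ (fun y : Amb n => ‖y‖ ^ 2)) x w w = 2 * ‖w‖ ^ 2 := by
      intro w
      rw [h2, ← real_inner_self_eq_norm_sq]; rfl
    rw [hν.sum_bilin_tangentFrame hx]
    simp only [h', hνx]
    simp
    ring
  have h5 := hexp x hx
  have hA := sqNormA_nonneg ν x
  have hn' : (0 : ℝ) < n := by exact_mod_cast Nat.pos_of_ne_zero hn
  rw [jacobiOp, laplaceBeltrami, h4, fderiv_norm_sq_eq, tangentGradient, tangentPart, h3]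
  simp only [smul_apply, smul_eq_mul, inner_sub_right, inner_smul_right, innerSL_apply_apply,
    real_inner_self_eq_norm_sq, real_inner_comm x]
  have h6 : meanCurvature ν x = 1 / 2 * inner ℝ x (ν x) := by linarith
  rw [h6]
  -- The contributions `⟨x, ν⟩²` from `𝐇` and `|x|² - ⟨x, ν⟩²` from the drift add up, so `L |x|² =
  -- 2n + |x|²/2 + |A|² |x|²`.
  have h7 : 0 ≤ sqNormA ν x * ‖x‖ ^ 2 := by positivity
  nlinarith [sq_nonneg ‖x‖]

/-- The first eigenvalue of `-L` is positive in the presence of a positive Jacobi field. -/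
lemma eigenvalue_pos (hn : n ≠ 0) (hN : IsClosed N) (hν : IsOrientedHypersurface N ν)
    (hexp : IsSelfExpander N ν) {v : Amb n → ℝ} (hv : IsPositiveJacobiField N ν v) {ρ : ℝ}
    {φ μ : Amb n → ℝ} (hφ : IsFirstDirichletEigenfunction N ν ρ φ μ) :
    ∀ x ∈ N ∩ Metric.ball 0 ρ, 0 < μ x := by
  intro x₁ hx₁
  by_contra! hμ
  -- Discards the part where `μ > 0`. As `μ` is locally constant, what remains is compact, and it
  -- contains an `N`-neighbourhood of each of its points in the open ball.
  set C : Set (Amb n) := (N ∩ Metric.closedBall 0 ρ) \ {x | x ∈ N ∩ Metric.ball 0 ρ ∧ 0 < μ x}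
    with hC
  have hCsub : C ⊆ N ∩ Metric.closedBall 0 ρ := Set.sdiff_subset
  have hcpt : IsCompact (N ∩ Metric.closedBall (0 : Amb n) ρ) :=
    (isCompact_closedBall _ _).inter_left hN
  have hCc : IsCompact C := by
    refine hcpt.of_isClosed_subset ?_ hCsub
    rw [← isOpen_compl_iff, isOpen_iff_mem_nhds]
    intro x hx
    by_cases hxN : x ∈ N ∩ Metric.closedBall 0 ρ
    · have hx' : x ∈ N ∩ Metric.ball 0 ρ ∧ 0 < μ x := by
        by_contra h; exact hx ⟨hxN, h⟩
      have h1 := hφ.locallyConstant x hx'.1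
      rw [eventually_nhdsWithin_iff] at h1
      filter_upwards [h1, Metric.isOpen_ball.mem_nhds hx'.1.2] with y hy hyb hyC
      exact hyC.2 ⟨⟨hyC.1.1, hyb⟩, by rw [hy hyC.1.1]; exact hx'.2⟩
    · filter_upwards [hcpt.isClosed.isOpen_compl.mem_nhds hxN] with y hy hyC using hy (hCsub hyC)
  have hx₁C : x₁ ∈ C :=
    ⟨⟨hx₁.1, Metric.ball_subset_closedBall hx₁.2⟩, fun h => absurd h.2 (not_lt.2 hμ)⟩
  have hvc : ContinuousOn v C := fun x hx =>
    (hv.smooth x (hCsub hx).1).continuousAt.continuousWithinAt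
  have hv0 : ∀ x ∈ C, v x ≠ 0 := fun x hx => (hv.pos x (hCsub hx).1).ne'
  obtain ⟨xm, hxm, hmin⟩ := hCc.exists_isMinOn ⟨x₁, hx₁C⟩ hvc
  have hvm := hv.pos xm (hCsub hxm).1
  -- The quotient `(φ + ε |x|²) / v` cannot peak in the open ball: there `L (φ + ε |x|² - m v) = -μ
  -- φ + ε L |x|² > 0`, against the maximum principle. On the sphere `φ = 0`, which leaves a bound
  -- of order `ε`. The perturbation `ε |x|²` replaces a strong maximum principle.
  have key : ∀ ε > 0, φ x₁ / v x₁ ≤ ε * (ρ ^ 2 / v xm) := by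
    intro ε hε
    have hcont : ContinuousOn (fun x => (φ x + ε * ‖x‖ ^ 2) / v x) C := by
      refine ContinuousOn.div ((hφ.continuousOn.mono hCsub).add ?_) hvc hv0
      fun_prop
    obtain ⟨p, hp, hmax⟩ := hCc.exists_isMaxOn ⟨x₁, hx₁C⟩ hcont
    have hpN := (hCsub hp).1
    have hpsphere : p ∈ Metric.sphere (0 : Amb n) ρ := by
      by_contra hps
      have hpb : p ∈ Metric.ball (0 : Amb n) ρ := by
        have := (hCsub hp).2
        rw [Metric.mem_closedBall] at this
        exact lt_of_le_of_ne this hps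
      have hμp : μ p ≤ 0 := by
        by_contra! h; exact hp.2 ⟨⟨hpN, hpb⟩, h⟩
      set m := (φ p + ε * ‖p‖ ^ 2) / v p with hm
      have hφs := contDiffAt_infty.1 (hφ.smooth p ⟨hpN, hpb⟩) 2
      have hvs := contDiffAt_infty.1 (hv.smooth p hpN) 2
      have hns : ContDiffAt ℝ 2 (fun y : Amb n => ‖y‖ ^ 2) p := (contDiff_norm_sq ℝ).contDiffAt
      have h1 : jacobiOp ν (fun y => (φ y + ε * ‖y‖ ^ 2) + (-m) * v y) p ≤ 0 := by
        refine jacobiOp_nonpos_of_isLocalMax hν hpN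
          ((hφs.add (contDiffAt_const.mul hns)).add (contDiffAt_const.mul hvs)) ?_ ?_
        · have := (hv.pos p hpN).ne'
          rw [hm]; field_simp; ring
        · have h2 := hφ.locallyConstant p ⟨hpN, hpb⟩
          rw [eventually_nhdsWithin_iff] at h2 ⊢
          filter_upwards [h2, Metric.isOpen_ball.mem_nhds hpb] with y hy hyb hyN
          have hyC : y ∈ C := ⟨⟨hyN, Metric.ball_subset_closedBall hyb⟩, fun h => by
            have := h.2; rw [hy hyN] at this; linarith⟩
          have h3 : (φ y + ε * ‖y‖ ^ 2) / v y ≤ m := hmax hyC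
          rw [div_le_iff₀ (hv.pos y hyN)] at h3
          linarith
      rw [jacobiOp_add (hφs.add (contDiffAt_const.mul hns)) (contDiffAt_const.mul hvs),
        jacobiOp_add hφs (contDiffAt_const.mul hns), jacobiOp_const_mul hns,
        jacobiOp_const_mul hvs, hv.jacobi p hpN] at h1
      have h4 := hφ.eigen p ⟨hpN, hpb⟩
      have h5 := mul_pos hε (jacobiOp_norm_sq_pos hn hν hexp hpN)
      have h6 := hφ.pos p ⟨hpN, hpb⟩
      nlinarith
    have h1 : (φ x₁ + ε * ‖x₁‖ ^ 2) / v x₁ ≤ (φ p + ε * ‖p‖ ^ 2) / v p := hmax hx₁C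
    have hpρ : ‖p‖ = ρ := by simpa using hpsphere
    rw [hφ.boundary p ⟨hpN, hpsphere⟩, zero_add, hpρ] at h1
    have hvx := hv.pos x₁ hx₁.1
    have hvp := hv.pos p hpN
    have h2 : v xm ≤ v p := hmin hp
    calc φ x₁ / v x₁ ≤ (φ x₁ + ε * ‖x₁‖ ^ 2) / v x₁ := by
          gcongr; linarith [show 0 ≤ ε * ‖x₁‖ ^ 2 by positivity]
      _ ≤ ε * ρ ^ 2 / v p := h1
      _ ≤ ε * ρ ^ 2 / v xm := by gcongr
      _ = _ := by ring
  have hpos : 0 < φ x₁ / v x₁ := div_pos (hφ.pos x₁ hx₁) (hv.pos x₁ hx₁.1)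
  have hD : 0 ≤ ρ ^ 2 / v xm := by positivity
  have h := key (φ x₁ / v x₁ / (2 * (ρ ^ 2 / v xm + 1))) (by positivity)
  have h2 : φ x₁ / v x₁ / (2 * (ρ ^ 2 / v xm + 1)) * (ρ ^ 2 / v xm) < φ x₁ / v x₁ := by
    rw [div_mul_eq_mul_div, div_lt_iff₀ (by positivity)]
    nlinarith
  linarith

/-! ### Curvature decay -/

/-- A map into the hypersurface has tangential derivative. -/
lemma IsOrientedHypersurface.inner_normal_fderiv_of_mem (hν : IsOrientedHypersurface N ν)
    {E : Type*} [NormedAddCommGroup E] [NormedSpace ℝ E] {c : E → Amb n} {z : E}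
    {c' : E →L[ℝ] Amb n} (hc : HasFDerivAt c c' z) (hN : ∀ᶠ y in 𝓝 z, c y ∈ N) (ζ : E) :
    inner ℝ (ν (c z)) (c' ζ) = 0 := by
  obtain ⟨F, -, hFN, hFg⟩ := hν.smooth (c z) hN.self_of_nhds
  have h2 := (hFg.differentiableAt.hasFDerivAt.comp z hc).fderiv
  have h3 : (F ∘ c) =ᶠ[𝓝 z] fun _ => 0 := by
    filter_upwards [hc.continuousAt.eventually hFN, hN] with y h4 h5 using h4.1 h5
  rw [← hFg.fderiv_apply]
  simpa using congrArg (fun l => l ζ) (h2.symm.trans h3.fderiv_eq)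

/-- The second fundamental form of a rescaled graph is bounded by the Hessian. -/
lemma sqNormA_le_of_graph (hν : IsOrientedHypersurface N ν) (T : Par n →ₗᵢ[ℝ] Amb n)
    {e p : Amb n} (he : ‖e‖ = 1) (hTe : ∀ z, inner ℝ (T z) e = 0) {ρ : ℝ} (hρ : 0 < ρ)
    {u : Par n → ℝ} {z₀ : Par n} (hu : ContDiffAt ℝ 2 u z₀)
    (hN : ∀ᶠ z in 𝓝 z₀, ρ⁻¹ • (p + T z + u z • e) ∈ N) {K : ℝ}
    (hK : ‖iteratedFDeriv ℝ 2 u z₀‖ ≤ K) :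
    sqNormA ν (ρ⁻¹ • (p + T z₀ + u z₀ • e)) ≤ (n + 1) * (K * ρ) ^ 2 := by
  set Γ : Par n → Amb n := fun z => ρ⁻¹ • (p + T z + u z • e) with hΓ
  set x := Γ z₀ with hx
  have hxN : x ∈ N := hN.self_of_nhds
  set D : Par n → Par n →L[ℝ] Amb n := fun z =>
    ρ⁻¹ • (T.toContinuousLinearMap + (fderiv ℝ u z).smulRight e) with hD
  have hΓd : ∀ᶠ z in 𝓝 z₀, HasFDerivAt Γ (D z) z := by
    filter_upwards [hu.eventually (by simp)] with z hz
    exact ((T.toContinuousLinearMap.hasFDerivAt.const_add p).add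
      ((hz.differentiableAt two_ne_zero).hasFDerivAt.smul_const e)).const_smul ρ⁻¹
  -- Lifting a tangent vector to the parameter space gains a factor `ρ`. Two lifts against the
  -- factor `ρ⁻¹` in `hform` leave one power of `ρ`.
  have hDn : ∀ ζ, ‖ζ‖ ≤ ρ * ‖D z₀ ζ‖ := by
    intro ζ
    have h1 : ‖T ζ + fderiv ℝ u z₀ ζ • e‖ ^ 2 = ‖ζ‖ ^ 2 + (fderiv ℝ u z₀ ζ) ^ 2 := by
      rw [norm_add_sq_real, inner_smul_right, hTe, T.norm_map, norm_smul, he]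
      simp
    have h2 : D z₀ ζ = ρ⁻¹ • (T ζ + fderiv ℝ u z₀ ζ • e) := by simp [hD]
    rw [h2, norm_smul, norm_inv, Real.norm_eq_abs, abs_of_pos hρ, mul_inv_cancel_left₀ hρ.ne']
    refine le_of_sq_le_sq ?_ (norm_nonneg _)
    rw [h1]
    nlinarith [sq_nonneg (fderiv ℝ u z₀ ζ)]
  have hDinj : Function.Injective (D z₀) := by
    rw [injective_iff_map_eq_zero]
    intro ζ h
    have := hDn ζ
    rw [h, norm_zero, mul_zero] at this
    exact norm_le_zero_iff.1 this
  have hDν : ∀ ζ, inner ℝ (ν x) (D z₀ ζ) = 0 :=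
    hν.inner_normal_fderiv_of_mem hΓd.self_of_nhds hN
  have hνx := hν.norm_normal x hxN
  have hν0 : ν x ≠ 0 := by intro h; simp [h] at hνx
  have hrange := range_eq_orthogonal hDinj hν0 hDν
  have hlift : ∀ ξ, inner ℝ (ν x) ξ = 0 → ∃ ζ, D z₀ ζ = ξ := by
    intro ξ hξ
    have : ξ ∈ LinearMap.range (D z₀).toLinearMap := by
      rw [hrange, Submodule.mem_orthogonal_singleton_iff_inner_right]; exact hξ
    exact this
  have hK0 : 0 ≤ K := (norm_nonneg _).trans hK
  have hform : ∀ ζ ζ', inner ℝ (fderiv ℝ ν x (D z₀ ζ)) (D z₀ ζ') =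
      -(ρ⁻¹ * (fderiv ℝ (fderiv ℝ u) z₀ ζ ζ' * inner ℝ (ν x) e)) := by
    intro ζ ζ'
    -- Differentiating this orthogonality expresses the second fundamental form through the Hessian
    -- of `u`.
    have h1 : (fun z => inner ℝ (ν (Γ z)) (D z ζ')) =ᶠ[𝓝 z₀] fun _ => (0 : ℝ) := by
      filter_upwards [hΓd, hN.eventually_nhds] with z h1 h2
      exact hν.inner_normal_fderiv_of_mem h1 h2 ζ'
    have h2 : HasFDerivAt (fun z => ν (Γ z)) ((fderiv ℝ ν x).comp (D z₀)) z₀ :=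
      HasFDerivAt.comp z₀ (g := ν) (f := Γ) (hν.differentiableAt_normal hxN).hasFDerivAt
        hΓd.self_of_nhds
    have h3 : HasFDerivAt (fun z => fderiv ℝ u z ζ') ((fderiv ℝ (fderiv ℝ u) z₀).flip ζ') z₀ := by
      have := (differentiableAt_fderiv_of_contDiffAt hu).hasFDerivAt.clm_apply
        (hasFDerivAt_const ζ' z₀)
      simpa using this
    have h4 : HasFDerivAt (fun z => D z ζ')
        (ρ⁻¹ • ((fderiv ℝ (fderiv ℝ u) z₀).flip ζ').smulRight e) z₀ := by
      have h5 : (fun z => D z ζ') = fun z => ρ⁻¹ • (T ζ' + fderiv ℝ u z ζ' • e) := by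
        ext1 z; simp [hD]
      rw [h5]
      exact ((h3.smul_const e).const_add _).const_smul ρ⁻¹
    have h6 := (h2.inner ℝ h4).fderiv
    rw [h1.fderiv_eq] at h6
    have h7 := congrArg (fun l => l ζ) h6
    simp only [fderiv_fun_const, Pi.zero_apply, zero_apply, ContinuousLinearMap.comp_apply,
      ContinuousLinearMap.prod_apply, fderivInnerCLM_apply, smul_apply,
      ContinuousLinearMap.smulRight_apply, ContinuousLinearMap.flip_apply,
      inner_smul_right] at h7
    linarith
  have hbound : ∀ ξ η, inner ℝ (ν x) ξ = 0 → inner ℝ (ν x) η = 0 →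
      inner ℝ (fderiv ℝ ν x ξ) η ≤ K * ρ * (‖ξ‖ * ‖η‖) := by
    intro ξ η hξ hη
    obtain ⟨ζ, rfl⟩ := hlift ξ hξ
    obtain ⟨ζ', rfl⟩ := hlift η hη
    rw [hform]
    have h1 : |fderiv ℝ (fderiv ℝ u) z₀ ζ ζ'| ≤ K * (‖ζ‖ * ‖ζ'‖) := by
      have h2 := (iteratedFDeriv ℝ 2 u z₀).le_opNorm ![ζ, ζ']
      rw [iteratedFDeriv_two_apply] at h2
      simp only [Matrix.cons_val_zero, Matrix.cons_val_one, Fin.prod_univ_two,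
        Real.norm_eq_abs] at h2
      exact h2.trans (by gcongr)
    have h2 : |inner ℝ (ν x) e| ≤ 1 := by
      have := abs_real_inner_le_norm (ν x) e
      rwa [hνx, he, one_mul] at this
    calc -(ρ⁻¹ * (fderiv ℝ (fderiv ℝ u) z₀ ζ ζ' * inner ℝ (ν x) e))
        ≤ |ρ⁻¹ * (fderiv ℝ (fderiv ℝ u) z₀ ζ ζ' * inner ℝ (ν x) e)| := neg_le_abs _
      _ = ρ⁻¹ * (|fderiv ℝ (fderiv ℝ u) z₀ ζ ζ'| * |inner ℝ (ν x) e|) := by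
          rw [abs_mul, abs_mul, abs_of_pos (inv_pos.2 hρ)]
      _ ≤ ρ⁻¹ * ((K * (‖ζ‖ * ‖ζ'‖)) * 1) := by gcongr
      _ ≤ ρ⁻¹ * ((K * ((ρ * ‖D z₀ ζ‖) * (ρ * ‖D z₀ ζ'‖))) * 1) := by
          gcongr
          · exact hDn ζ
          · exact hDn ζ'
      _ = K * ρ * (‖D z₀ ζ‖ * ‖D z₀ ζ'‖) := by field_simp
  have hτ : ∀ i, ‖fderiv ℝ ν x (tangentFrame ν x i)‖ ^ 2 ≤ (K * ρ) ^ 2 := by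
    intro i
    have hortho := hν.inner_normal_tangentPart hxN (EuclideanSpace.single i (1 : ℝ))
    set τ := tangentFrame ν x i with hτ
    have h1 := hbound τ (fderiv ℝ ν x τ) hortho (hν.shape_tangent hxN hortho)
    rw [real_inner_self_eq_norm_sq] at h1
    have h2 : ‖τ‖ ≤ 1 := by
      have h3 : ‖τ‖ ^ 2 = 1 - ν x i ^ 2 := by
        rw [hτ, tangentFrame_eq, norm_sub_sq_real, inner_smul_right, inner_single_left, norm_smul,
          hνx]
        simp
        ring
      refine le_of_sq_le_sq ?_ zero_le_one
      rw [h3]; nlinarith [sq_nonneg (ν x i)]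
    have h4 : ‖fderiv ℝ ν x τ‖ ≤ K * ρ := by
      by_contra! h5
      have h6 : 0 ≤ K * ρ := by positivity
      have h7 : K * ρ * (‖τ‖ * ‖fderiv ℝ ν x τ‖) ≤ K * ρ * (1 * ‖fderiv ℝ ν x τ‖) := by gcongr
      nlinarith
    gcongr
  calc sqNormA ν x ≤ ∑ _i : Fin (n + 1), (K * ρ) ^ 2 := Finset.sum_le_sum fun i _ => hτ i
    _ = _ := by simp

/-- The second fundamental form of a hypersurface which is smoothly asymptotic to a cone tends to
`0` at infinity. -/
lemma exists_forall_sqNormA_lt (hν : IsOrientedHypersurface N ν) {C : Set (Amb n)}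
    (hasym : IsAsymptoticTo N C) {κ : ℝ} (hκ : 0 < κ) :
    ∃ R > 0, ∀ x ∈ N, R ≤ ‖x‖ → sqNormA ν x < κ := by
  -- To be used with `q = (‖x‖⁻¹, ‖x‖⁻¹ • x)`: compactness of the unit sphere then makes the local
  -- estimates uniform at infinity.
  have hloc : ∀ p ∈ Metric.sphere (0 : Amb n) 1, ∀ᶠ q : ℝ × Amb n in 𝓝 (0, p),
      0 < q.1 → ∀ x ∈ N, q.1 • x = q.2 → sqNormA ν x < κ := by
    intro p hp
    have hp0 : p ∈ ({0}ᶜ : Set (Amb n)) := by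
      intro h; rw [Set.mem_singleton_iff] at h; simp [h] at hp
    by_cases hpC : p ∈ C
    · obtain ⟨T, e, r, u₀, u, he, hTe, hr, hu₀, -, hu, hconv⟩ := hasym.2 p hp0 hpC
      have hcont : ContinuousAt (iteratedFDeriv ℝ 2 u₀) 0 := by
        have h1 : ContDiffAt ℝ ∞ u₀ 0 := hu₀.contDiffAt (Metric.ball_mem_nhds 0 hr)
        exact ((contDiffAt_infty.1 h1 2).iteratedFDeriv_right (m := 0) (i := 2)
          (by norm_num)).continuousAt
      -- One unit allows for the variation of `D²u₀` near `0`; a second unit, in `K + 1` below, for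
      -- its distance from `D²u`.
      set K := ‖iteratedFDeriv ℝ 2 u₀ 0‖ + 1 with hK
      have h1 : ∀ᶠ z in 𝓝 (0 : Par n), ‖iteratedFDeriv ℝ 2 u₀ z‖ < K :=
        hcont.norm.eventually (gt_mem_nhds (by linarith))
      rw [Metric.eventually_nhds_iff] at h1
      obtain ⟨r₁, hr₁, h1⟩ := h1
      have h2 := Metric.tendstoUniformlyOn_iff.1 (hconv 2) 1 one_pos
      have h3 : ∀ᶠ ρ in 𝓝[>] (0 : ℝ), (n + 1) * ((K + 1) * ρ) ^ 2 < κ := by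
        have h4 : Filter.Tendsto (fun ρ : ℝ => (n + 1) * ((K + 1) * ρ) ^ 2) (𝓝 0) (𝓝 0) := by
          have : Continuous fun ρ : ℝ => ((n : ℝ) + 1) * ((K + 1) * ρ) ^ 2 := by fun_prop
          simpa using this.tendsto 0
        exact (h4.mono_left nhdsWithin_le_nhds).eventually (gt_mem_nhds hκ)
      have h4 : ∀ᶠ ρ in 𝓝 (0 : ℝ), 0 < ρ → (n + 1) * ((K + 1) * ρ) ^ 2 < κ ∧
          (∀ z ∈ Metric.ball 0 r,
            dist (iteratedFDeriv ℝ 2 u₀ z) (iteratedFDeriv ℝ 2 (u ρ) z) < 1) ∧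
          ContDiffOn ℝ ∞ (u ρ) (Metric.ball 0 r) ∧
          ∀ z ∈ Metric.ball (0 : Par n) r, ∀ y : ℝ, |y| < r →
            (p + T z + y • e ∈ (fun x => ρ • x) '' N ↔ y = u ρ z) := by
        have := (h3.and (h2.and hu))
        rw [eventually_nhdsWithin_iff] at this
        exact this
      have hball : ∀ᶠ q : ℝ × Amb n in 𝓝 (0, p), q.2 ∈ Metric.ball p (min r r₁) :=
        (continuous_snd.tendsto ((0 : ℝ), p)).eventually
          (Metric.ball_mem_nhds p (lt_min hr hr₁))
      filter_upwards [(continuous_fst.tendsto ((0 : ℝ), p)).eventually h4, hball] with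
        q h5 hq hρ x hxN hxq
      obtain ⟨h6, h7, h8, h9⟩ := h5 hρ
      set ρ := q.1 with hρdef
      set d := ρ • x - p with hd
      have hdn : ‖d‖ < min r r₁ := by
        rw [hd, hxq, ← dist_eq_norm]; exact hq
      -- decompose `d` in the frame of the cylinder
      have he0 : e ≠ 0 := by intro h; simp [h] at he
      have hrange := range_eq_orthogonal (D := T.toContinuousLinearMap) T.injective he0 fun ζ => by
        rw [real_inner_comm]; exact hTe ζ
      have hdmem : d - inner ℝ e d • e ∈
          LinearMap.range T.toContinuousLinearMap.toLinearMap := by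
        rw [hrange, Submodule.mem_orthogonal_singleton_iff_inner_right, inner_sub_right,
          inner_smul_right, real_inner_self_eq_norm_sq, he]
        ring
      obtain ⟨z, hz⟩ := hdmem
      have hz' : T z = d - inner ℝ e d • e := hz
      set y := inner ℝ e d with hy
      have hyn : |y| ≤ ‖d‖ := by
        have := abs_real_inner_le_norm e d
        rwa [he, one_mul] at this
      have hzn : ‖z‖ ≤ ‖d‖ := by
        rw [← T.norm_map, hz']
        refine le_of_sq_le_sq ?_ (norm_nonneg _)
        rw [norm_sub_sq_real, inner_smul_right, real_inner_comm, ← hy, norm_smul, he,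
          Real.norm_eq_abs, mul_one, sq_abs]
        nlinarith [sq_nonneg y]
      have hzr : z ∈ Metric.ball (0 : Par n) r := by
        rw [mem_ball_zero_iff]; exact (hzn.trans_lt hdn).trans_le (min_le_left _ _)
      have hyr : |y| < r := (hyn.trans_lt hdn).trans_le (min_le_left _ _)
      have hpz : p + T z + y • e = ρ • x := by rw [hz', hd]; abel
      have hyu : y = u ρ z := (h9 z hzr y hyr).1 (by rw [hpz]; exact ⟨x, hxN, rfl⟩)
      have hus : ContDiffAt ℝ 2 (u ρ) z :=
        contDiffAt_infty.1 (h8.contDiffAt (Metric.isOpen_ball.mem_nhds hzr)) 2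
      have hgraph : ∀ᶠ z' in 𝓝 z, ρ⁻¹ • (p + T z' + u ρ z' • e) ∈ N := by
        have h10 : ∀ᶠ z' in 𝓝 z, |u ρ z'| < r :=
          hus.continuousAt.abs.eventually (gt_mem_nhds (by change |u ρ z| < r; rwa [← hyu]))
        filter_upwards [h10, Metric.isOpen_ball.mem_nhds hzr] with z' h11 h12
        obtain ⟨x', hx', hxe⟩ := (h9 z' h12 _ h11).2 rfl
        rw [← hxe]
        simpa [smul_smul, inv_mul_cancel₀ hρ.ne'] using hx'
      have hKz : ‖iteratedFDeriv ℝ 2 (u ρ) z‖ ≤ K + 1 := by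
        have h10 := h7 z hzr
        rw [dist_eq_norm] at h10
        have h11 := @h1 z (by
          rw [dist_zero_right]; exact (hzn.trans_lt hdn).trans_le (min_le_right _ _))
        have h12 := norm_sub_norm_le (iteratedFDeriv ℝ 2 (u ρ) z) (iteratedFDeriv ℝ 2 u₀ z)
        rw [norm_sub_rev] at h12
        linarith
      have hfinal := sqNormA_le_of_graph hν T he hTe hρ hus hgraph hKz
      rw [← hyu, hpz, smul_smul, inv_mul_cancel₀ hρ.ne', one_smul] at hfinal
      exact hfinal.trans_lt h6
    · obtain ⟨r, hr, hdisj⟩ := hasym.1 p hp0 hpC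
      rw [eventually_nhdsWithin_iff] at hdisj
      filter_upwards [(continuous_fst.tendsto ((0 : ℝ), p)).eventually hdisj,
        (continuous_snd.tendsto ((0 : ℝ), p)).eventually (Metric.ball_mem_nhds p hr)] with
        q h1 h2 hρ x hxN hxq
      exact absurd ⟨x, hxN, hxq⟩ (Set.disjoint_left.1 (h1 hρ) h2)
  have hev := (isCompact_sphere (0 : Amb n) 1).eventually_forall_of_forall_eventually
    (P := fun ρ y => 0 < ρ → ∀ x ∈ N, ρ • x = y → sqNormA ν x < κ) hloc
  rw [Metric.eventually_nhds_iff] at hev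
  obtain ⟨δ, hδ, hev⟩ := hev
  refine ⟨2 / δ, by positivity, fun x hxN hx => ?_⟩
  have hx0 : 0 < ‖x‖ := lt_of_lt_of_le (by positivity) hx
  refine @hev ‖x‖⁻¹ ?_ (‖x‖⁻¹ • x) ?_ (by positivity) x hxN rfl
  · rw [Real.dist_eq, sub_zero, abs_of_pos (by positivity)]
    rw [inv_lt_comm₀ hx0 hδ]
    refine lt_of_lt_of_le ?_ hx
    rw [inv_eq_one_div]
    gcongr
    norm_num
  · rw [mem_sphere_zero_iff_norm, norm_smul, norm_inv, norm_norm, inv_mul_cancel₀ hx0.ne']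

/-- The second fundamental form of an asymptotically conical hypersurface is bounded. -/
lemma exists_forall_sqrt_sqNormA_le (hN : IsClosed N) (hν : IsOrientedHypersurface N ν)
    {C : Set (Amb n)} (hasym : IsAsymptoticTo N C) :
    ∃ A > 0, ∀ x ∈ N, Real.sqrt (sqNormA ν x) ≤ A := by
  obtain ⟨R, -, hR⟩ := exists_forall_sqNormA_lt hν hasym one_pos
  have hcpt : IsCompact (N ∩ Metric.closedBall (0 : Amb n) R) :=
    (isCompact_closedBall _ _).inter_left hN
  have hc : ContinuousOn (fun x => Real.sqrt (sqNormA ν x)) (N ∩ Metric.closedBall 0 R) :=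
    fun x hx => (hν.continuousAt_sqNormA hx.1).sqrt.continuousWithinAt
  obtain ⟨B, hB⟩ := hcpt.exists_bound_of_continuousOn hc
  refine ⟨max B 1, by positivity, fun x hx => ?_⟩
  by_cases h : ‖x‖ ≤ R
  · exact ((le_abs_self _).trans (hB x ⟨hx, by simpa using h⟩)).trans (le_max_left _ _)
  · exact (Real.sqrt_le_one.2 (hR x hx (not_le.1 h).le).le).trans (le_max_right _ _)

/-! ### Welding the two barriers and choosing the constants. -/

/-- The welded function is a barrier where both of its pieces are. -/
lemma noTouchAt_welded {f : Amb n → ℝ} {h R s : ℝ} (hR : 0 < R) (hs : 0 < s) {x₀ : Amb n}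
    (hf : ‖x₀‖ ≤ 2 * R → NoTouchAt N ν (fun x => s * f x) x₀)
    (hh : R ≤ ‖x₀‖ → NoTouchAt N ν (fun _ => s * h) x₀)
    (hfh : ‖x₀‖ = 2 * R → h ≤ f x₀) : NoTouchAt N ν (fun x => s * welded f h R x) x₀ := by
  have hout : R < ‖x₀‖ → ∀ᶠ x in 𝓝[N] x₀, s * welded f h R x ≤ s * h := by
    intro hx
    filter_upwards [nhdsWithin_le_nhds (continuous_norm.continuousAt.eventually
      (lt_mem_nhds hx))] with x hx'
    gcongr
    rw [welded, if_neg (not_le.2 hx')]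
    split_ifs
    exacts [min_le_right _ _, le_rfl]
  have hinn : ‖x₀‖ < 2 * R → ∀ᶠ x in 𝓝[N] x₀, s * welded f h R x ≤ s * f x := by
    intro hx
    filter_upwards [nhdsWithin_le_nhds (continuous_norm.continuousAt.eventually
      (gt_mem_nhds hx))] with x hx'
    gcongr
    rw [welded]
    split_ifs with h1 h2
    exacts [le_rfl, min_le_left _ _, absurd hx'.le h2]
  -- Each case selects a piece that equals the welded function at `x₀` and dominates it nearby: `f`
  -- up to radius `R`, the smaller of `f` and `h` in the open annulus, and `h` from radius `2R` on,
  -- where `hfh` rules out a jump.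
  rcases le_or_gt ‖x₀‖ R with h1 | h1
  · exact (hf (by linarith)).mono (hinn (by linarith)) (by simp [welded, h1])
  rcases lt_or_ge ‖x₀‖ (2 * R) with h2 | h2
  · rcases le_total (f x₀) h with h3 | h3
    · exact (hf h2.le).mono (hinn h2) (by simp [welded, h1.not_ge, h2.le, h3])
    · exact (hh h1.le).mono (hout h1) (by simp [welded, h1.not_ge, h2.le, h3])
  · refine (hh h1.le).mono (hout h1) ?_
    rcases h2.eq_or_lt with h3 | h3
    · simp [welded, h1.not_ge, h3.ge, hfh h3.symm]
    · simp [welded, h1.not_ge, h3.not_ge]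

lemma abs_welded_le {f : Amb n → ℝ} {h R B : ℝ} (hR : 0 < R) {x : Amb n}
    (hf : ‖x‖ ≤ 2 * R → |f x| ≤ B) (hh : |h| ≤ B) : |welded f h R x| ≤ B := by
  rw [welded]
  split_ifs with h1 h2
  · exact hf (by linarith)
  · rcases min_choice (f x) h with h3 | h3 <;> rw [h3]
    exacts [hf h2, hh]
  · exact hh

end ExpanderBarrier

theorem proposition3p4 (n : ℕ) [NeZero n] (hn : 2 ≤ n)
    -- the smooth cone over `S`, bounding `W`; its level set flow fattens
    (S : Set (Amb n)) (hS : IsSmoothLink S)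
    (W : Set (Amb n)) (hW : closure (interior W) = W) (hWS : frontier W = coneOver S)
    (hfat : Fattens (coneOver S))
    -- the outermost expander, smooth, with unit normal pointing into the level set flow of the cone
    (N : Set (Amb n)) (hN : N = frontier (levelSetFlow W 1))
    (ν : Amb n → Amb n) (hν : IsOrientedHypersurface N ν)
    (hexp : IsSelfExpander N ν) (hasym : IsAsymptoticTo N (coneOver S))
    (hin : ∀ x ∈ N, ∀ᶠ t in 𝓝[>] (0 : ℝ), x + t • ν x ∈ levelSetFlow (coneOver S) 1)
    -- the positive Jacobi field
    (v : Amb n → ℝ) (hv : IsPositiveJacobiField N ν v) :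
    ∃ R₀ > 0, ∀ R ≥ R₀, ∀ φ μ : Amb n → ℝ, IsFirstDirichletEigenfunction N ν (3 * R) φ μ →
      ∃ α₀ > 0, ∀ α ∈ Set.Ioo 0 α₀,
        ∀ h : ℝ, IsGreatest ((fun x => v x + α * φ x) '' (N ∩ Metric.sphere 0 R)) h →
          ∃ s₀ > 0, ∀ s ∈ Set.Ioo 0 s₀,
            IsStaticSupersolution N ν
              (fun x => s * welded (fun x => v x + α * φ x) h R x) := by
  have hNc : IsClosed N := hN ▸ isClosed_frontier
  obtain ⟨R₁, hR₁, hAR⟩ := exists_forall_sqNormA_lt hν hasym (κ := 1 / 4) (by norm_num)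
  obtain ⟨A, hA, hAle⟩ := exists_forall_sqrt_sqNormA_le hNc hν hasym
  obtain ⟨K, r₁, hr₁, hdecay⟩ := hv.decay
  -- `R₁` gives `|A|² < 1/4` and `r₁` the decay of `v - r`. The last entry ensures `R + |K| + 1 ≤ 2R
  -- - |K|`, an upper bound for `h` against a lower bound for `f` at radius `2R`.
  refine ⟨max R₁ (max r₁ (1 + 2 * |K|)), by positivity, fun R hR φ μ hφ => ?_⟩
  have hRR₁ : R₁ ≤ R := (le_max_left _ _).trans hR
  have hRr₁ : r₁ ≤ R := (le_max_left _ _).trans ((le_max_right _ _).trans hR)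
  have hRK : 1 + 2 * |K| ≤ R := (le_max_right _ _).trans ((le_max_right _ _).trans hR)
  have hR1 : 1 ≤ R := by linarith [abs_nonneg K]
  have hR0 : 0 < R := by linarith
  -- Lies strictly inside the ball of radius `3R`, so `φ` is smooth and positive on all of this
  -- compact set.
  set C : Set (Amb n) := N ∩ Metric.closedBall 0 (2 * R) with hC
  have hCc : IsCompact C := (isCompact_closedBall _ _).inter_left hNc
  have hCb : ∀ x ∈ C, x ∈ N ∩ Metric.ball 0 (3 * R) := fun x hx =>
    ⟨hx.1, Metric.closedBall_subset_ball (by linarith) hx.2⟩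
  have hCn : ∀ x ∈ N, ‖x‖ ≤ 2 * R → x ∈ C := fun x hx h => ⟨hx, by simpa using h⟩
  obtain ⟨M, hM⟩ := hCc.exists_bound_of_continuousOn (f := φ) fun x hx =>
    (hφ.smooth x (hCb x hx)).continuousAt.continuousWithinAt
  -- Makes `α φ ≤ 1` on `C`, the error allowed for in `R₀`.
  refine ⟨1 / (|M| + 1), by positivity, fun α hα h hh => ?_⟩
  obtain ⟨hα0, hα1⟩ := hα
  rw [lt_div_iff₀ (by positivity)] at hα1
  set f : Amb n → ℝ := fun x => v x + α * φ x with hf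
  obtain ⟨xh, ⟨hxhN, hxhR⟩, hxh⟩ := hh.1
  have hxhR' : ‖xh‖ = R := by simpa using hxhR
  have hxhC : xh ∈ C := hCn xh hxhN (by linarith)
  have hfpos : ∀ x ∈ C, 0 < f x := fun x hx =>
    add_pos (hv.pos x hx.1) (mul_pos hα0 (hφ.pos x (hCb x hx)))
  have hh0 : 0 < h := hxh ▸ hfpos xh hxhC
  have hfh : ∀ x ∈ N, ‖x‖ = 2 * R → h ≤ f x := by
    intro x hx hxR
    have h1 := (abs_le.1 (hdecay x hx (by linarith)).1).1
    have h2 := (abs_le.1 (hdecay xh hxhN (by linarith)).1).2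
    have h3 : K / ‖x‖ ≤ |K| := (div_le_div_of_nonneg_right (le_abs_self K) (norm_nonneg x)).trans
      (div_le_self (abs_nonneg K) (by linarith))
    have h4 : K / ‖xh‖ ≤ |K| := (div_le_div_of_nonneg_right (le_abs_self K) (norm_nonneg xh)).trans
      (div_le_self (abs_nonneg K) (by linarith))
    have h5 : α * φ xh ≤ 1 := by
      have h6 : φ xh ≤ |M| := (le_abs_self _).trans ((hM xh hxhC).trans (le_abs_self M))
      nlinarith
    have h6 : 0 < α * φ x := mul_pos hα0 (hφ.pos x (hCb x (hCn x hx hxR.le)))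
    have h7 : v xh + α * φ xh = h := hxh
    change h ≤ v x + α * φ x
    linarith
  have hfs : ∀ x ∈ C, ContDiffAt ℝ 3 f x := fun x hx =>
    (contDiffAt_infty.1 (hv.smooth x hx.1) 3).add
      (contDiffAt_const.mul (contDiffAt_infty.1 (hφ.smooth x (hCb x hx)) 3))
  have hfL : ∀ x ∈ C, jacobiOp ν f x < 0 := by
    intro x hx
    have hφs := contDiffAt_infty.1 (hφ.smooth x (hCb x hx)) 2
    rw [hf, jacobiOp_add (contDiffAt_infty.1 (hv.smooth x hx.1) 2) (contDiffAt_const.mul hφs),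
      jacobiOp_const_mul hφs, hv.jacobi x hx.1, zero_add]
    have h1 := hφ.eigen x (hCb x hx)
    have h2 := mul_pos (eigenvalue_pos (NeZero.ne n) hNc hν hexp hv hφ x (hCb x hx))
      (hφ.pos x (hCb x hx))
    exact mul_neg_of_pos_of_neg hα0 (by linarith)
  obtain ⟨s₁, hs₁, hbar⟩ := exists_forall_noTouchAt_smul hν hexp hCc (fun x hx => hx.1) hfs hfL
  obtain ⟨B, hB⟩ := hCc.exists_bound_of_continuousOn (f := f) fun x hx =>
    (hfs x hx).continuousAt.continuousWithinAt
  have hBpos : 0 < max B h := lt_max_of_lt_right hh0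
  -- The second entry bounds `s |u| |A|` by `1/2`, which serves both admissibility and the
  -- hypothesis of `noTouchAt_const`.
  refine ⟨min s₁ (1 / (2 * (max B h * A))), lt_min hs₁ (by positivity), fun s hs => ?_⟩
  have hs0 : 0 < s := hs.1
  have hs₁' : s < s₁ := hs.2.trans_le (min_le_left _ _)
  have hs2 : s * (max B h * A) ≤ 1 / 2 := by
    have := (hs.2.trans_le (min_le_right _ _)).le
    rw [le_div_iff₀ (by positivity)] at this
    linarith
  refine ⟨⟨1 / 2, by norm_num, fun x hx => ?_⟩, fun U a b X hX z₀ hz x₀ hx₀ => ?_⟩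
  · have h1 : |welded f h R x| ≤ max B h := abs_welded_le hR0
      (fun hxR => (hB x (hCn x hx hxR)).trans (le_max_left _ _))
      (by rw [abs_of_pos hh0]; exact le_max_right _ _)
    calc |s * welded f h R x| * Real.sqrt (sqNormA ν x)
        = s * (|welded f h R x| * Real.sqrt (sqNormA ν x)) := by
          rw [abs_mul, abs_of_pos hs0, mul_assoc]
      _ ≤ s * (max B h * A) := by gcongr; exact hAle x hx
      _ ≤ 1 / 2 := hs2
  · refine noTouchAt_welded (f := f) hR0 hs0
      (fun hxR => hbar s ⟨hs0, hs₁'⟩ x₀ (hCn x₀ hx₀ hxR)) (fun hxR => ?_) (hfh x₀ hx₀) U a b X hX z₀ hz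
    refine noTouchAt_const hν hexp hx₀ (mul_pos hs0 hh0) ?_ (hAR x₀ hx₀ (hRR₁.trans hxR))
    calc s * h * Real.sqrt (sqNormA ν x₀) ≤ s * max B h * A := by
          gcongr
          exacts [le_max_right _ _, hAle x₀ hx₀]
      _ ≤ 1 / 2 := by rw [mul_assoc]; exact hs2
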